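/- **Theorem (Regularization Effects).** Let $\|\cdot\|$ be a norm on $\mathbb{R}^d$ with dual norm $\|\cdot\|_*$, let $\mathbb{B}_\rho(z)$ be the closed ball of radius $\rho$ around $z$, let $\nu_z$ be the uniform distribution on $\mathbb{B}_\rho(z)$ and $\beta$ the uniform distribution on $\mathbb{B}_1(0)$. Let $\phi:\mathbb{R}\to[0,\infty]$ be convex and lower semicontinuous with $\phi(1)=0$ and $\phi(x)=\infty$ for $x<0$, and let $\phi^*(s)=\sup_{t}\{st-\phi(t)\}$. Let $\hat{\mathbb{P}}$ be a probability distribution on $\mathbb{R}^d$, and put $\mathrm{d}\gamma_0(z,z')=\mathrm{d}\hat{\mathbb{P}}(z)\,\mathrm{d}\nu_z(z')$ and $\mathbb{D}_\phi(\gamma,\gamma_0)=\mathbb{E}_{\gamma_0}[\phi(\mathrm{d}\gamma/\mathrm{d}\gamma_0)]$ if $\gamma\ll\gamma_0$, and $\mathbb{D}_\phi(\gamma,\gamma_0)=\infty$ otherwise. Let $f:\mathbb{R}^d\to\mathbb{R}$ be differentiable with $\|\nabla f(x)-\nabla f(x')\|_*\le S(x)\|x-x'\|$ for all $x,x'$,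 where $f$, $\|\nabla f\|_*$ and $S$ are $\hat{\mathbb{P}}$-integrable. For $\rho,\eta>0$ let $$\mathcal{E}(\rho,\eta)=\sup_{\mathbb{P},\gamma}\Big\{\mathbb{E}_{z\sim\mathbb{P}}[f(z)]-\eta\,\mathbb{D}_\phi(\gamma,\gamma_0)\Big\}-\mathbb{E}_{z\sim\hat{\mathbb{P}}}[f(z)],$$ where the supremum is over all probability measures $\gamma$ on $\mathbb{R}^d\times\mathbb{R}^d$ whose first marginal is $\hat{\mathbb{P}}$ and whose second marginal is $\mathbb{P}$, and for which $\|\zeta_1-\zeta_2\|\le\rho$ for $\gamma$-almost every $(\zeta_1,\zeta_2)$. Suppose that $\rho\to0$ and $\eta\to0$ with $\rho,\eta>0$. 1. If $\rho/\eta\to C\in(0,\infty)$, then $|\mathcal{E}(\rho,\eta)-\mathcal{R}_1|=o(\rho)$, where $$\mathcal{R}_1=\rho\cdot\mathbb{E}_{z\sim\hat{\mathbb{P}}}\Big[\inf_{\mu\in\mathbb{R}}\Big\{\mu+\tfrac1C\,\mathbb{E}_{b\sim\beta}\big[\phi^*\big(C(\nabla f(z)^{\mathrm T}b-\mu)\big)\big]\Big\}\Big].$$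 2. Suppose that either $\lim_{t\to\infty}\phi(t)/t<\infty$ and $\phi$ is finite on $(0,\infty)$, or $\lim_{t\to\infty}\phi(t)/t=\infty$ and $\mathrm{dom}(\phi)=[0,\infty)$. If $\rho/\eta\to\infty$, then $$\Big|\mathcal{E}(\rho,\eta)-\rho\cdot\mathbb{E}_{z\sim\hat{\mathbb{P}}}\big[\|\nabla f(z)\|_*\big]\Big|=o(\rho).$$ 3. Suppose that $\phi$ is (finite and) twice continuously differentiable in a neighborhood of $1$ with $\phi''(1)>0$, and that $\mathbb{E}_{z\sim\hat{\mathbb{P}}}\big[\mathrm{Var}_{b\sim\beta}[\nabla f(z)^{\mathrm T}b]\big]<\infty$. If $\rho/\eta\to0$, then $$\Big|\mathcal{E}(\rho,\eta)-\frac{\rho^2}{2\eta\,\phi''(1)}\cdot\mathbb{E}_{z\sim\hat{\mathbb{P}}}\big[\mathrm{Var}_{b\sim\beta}[\nabla f(z)^{\mathrm T}b]\big]\Big|=o(\rho).$$ -/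

import Mathlib

open MeasureTheory ProbabilityTheory Filter Topology
open scoped ENNReal NNReal

noncomputable section

namespace RobustReg

/-- Divergence functions: convex lower semicontinuous `φ : ℝ → [0, ∞]` with `φ 1 = 0` and
`φ = ∞` on the negative reals. Convexity is with respect to nonnegative real weights, with
Mathlib's convention `0 • ∞ = 0`. -/
structure IsDivergenceFunction (φ : ℝ → ℝ≥0∞) : Prop where
  convex : ConvexOn ℝ≥0 Set.univ φ
  lsc : LowerSemicontinuous φ
  one : φ 1 = 0
  neg : ∀ t < 0, φ t = ⊤

/-- Popping property: `φ t / t` has a finite limit at infinity (and `φ` is finite on `(0, ∞)`). -/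
def Popping (φ : ℝ → ℝ≥0∞) : Prop :=
  (∃ L : ℝ≥0∞, L < ⊤ ∧ Tendsto (fun t : ℝ => φ t / ENNReal.ofReal t) atTop (𝓝 L)) ∧
    ∀ t > 0, φ t < ⊤

/-- Non-popping property: `φ t / t → ∞` at infinity, together with `dom φ = [0, ∞)`. -/
def NonPopping (φ : ℝ → ℝ≥0∞) : Prop :=
  Tendsto (fun t : ℝ => φ t / ENNReal.ofReal t) atTop (𝓝 ⊤) ∧ {t | φ t < ⊤} = Set.Ici 0

/-- The convex conjugate `φ*(s) = sup_t (s t - φ t)`. -/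
def conj (φ : ℝ → ℝ≥0∞) (s : ℝ) : EReal :=
  ⨆ t : ℝ, ((s * t : ℝ) : EReal) - (φ t : EReal)

/-- Expectation of an extended real function: integral of the positive part minus integral of
the negative part. -/
def eexp {Ω : Type*} [MeasurableSpace Ω] (m : Measure Ω) (u : Ω → EReal) : EReal :=
  ((∫⁻ x, (u x).toENNReal ∂m : ℝ≥0∞) : EReal) - ((∫⁻ x, (-u x).toENNReal ∂m : ℝ≥0∞) : EReal)

section Space

variable {E : Type*} [NormedAddCommGroup E] [NormedSpace ℝ E] [FiniteDimensional ℝ E]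
  [MeasurableSpace E] [BorelSpace E]

/-- Uniform probability measure on the closed ball of radius `ρ` around `z`: Lebesgue measure
(a Haar measure, whose normalization is immaterial) conditioned on the ball. -/
def unifBall (ρ : ℝ) (z : E) : Measure E :=
  ProbabilityTheory.cond (Measure.addHaar : Measure E) (Metric.closedBall z ρ)

theorem measurable_unifBall (ρ : ℝ) : Measurable (unifBall ρ : E → Measure E) := by
  have hE : SecondCountableTopology E := inferInstance
  have hball : MeasurableSet {p : E × E | dist p.2 p.1 ≤ ρ} := by
    have hc : Continuous fun p : E × E => dist p.2 p.1 := by fun_prop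
    exact (isClosed_le hc continuous_const).measurableSet
  refine Measure.measurable_of_measurable_coe _ fun s hs => ?_
  generalize hm : (Measure.addHaar : Measure E) = m
  have hfin : SFinite m := hm ▸ inferInstance
  have h1 : Measurable fun z : E => m (Metric.closedBall z ρ) :=
    measurable_measure_prodMk_left (ν := m) hball
  have h2 : Measurable fun z : E => m (Metric.closedBall z ρ ∩ s) :=
    measurable_measure_prodMk_left (ν := m) (hball.inter (measurable_snd hs))
  have h3 : (fun z : E => unifBall ρ z s) = fun z : E =>
      (m (Metric.closedBall z ρ))⁻¹ * m (Metric.closedBall z ρ ∩ s) := by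
    funext z
    rw [unifBall, hm]
    exact cond_apply Metric.isClosed_closedBall.measurableSet _ s
  rw [h3]
  exact h1.inv.mul h2

/-- The transition kernel `z ↦ ν_z`, with `ν_z` uniform on the ball of radius `ρ` around `z`. -/
def unifKernel (ρ : ℝ) : Kernel E E := ⟨unifBall ρ, measurable_unifBall ρ⟩

instance instIsFiniteKernelUnifKernel (ρ : ℝ) : IsFiniteKernel (unifKernel ρ : Kernel E E) := by
  refine ⟨⟨1, ENNReal.one_lt_top, fun z => ?_⟩⟩
  change ProbabilityTheory.cond (Measure.addHaar : Measure E) (Metric.closedBall z ρ)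
    Set.univ ≤ 1
  exact prob_le_one

/-- The reference measure `dγ₀(z, z') = dP(z) dν_z(z')`. -/
def refMeasure (P : Measure E) (ρ : ℝ) : Measure (E × E) := P ⊗ₘ unifKernel ρ

open Classical in
/-- The `φ`-divergence `E_{γ₀}[φ(dγ/dγ₀)]`, equal to `∞` when `γ` has no density. -/
def phiDiv {Ω : Type*} [MeasurableSpace Ω] (φ : ℝ → ℝ≥0∞) (γ γ₀ : Measure Ω) : ℝ≥0∞ :=
  if γ ≪ γ₀ then ∫⁻ x, φ (γ.rnDeriv γ₀ x).toReal ∂γ₀ else ⊤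

/-- Optimal value of the `φ`-regularized adversarial problem: the supremum of
`E_Q[f] - η D_φ(γ, γ₀)` over probability measures `Q` and `γ` such that `γ` has marginals `P`
and `Q`, and `‖ζ₁ - ζ₂‖ ≤ ρ` holds `γ`-almost surely. -/
def robustValue (φ : ℝ → ℝ≥0∞) (P : Measure E) (f : E → ℝ) (ρ η : ℝ) : EReal :=
  sSup {v : EReal | ∃ (Q : Measure E) (γ : Measure (E × E)), IsProbabilityMeasure γ ∧
    γ.map Prod.fst = P ∧ γ.map Prod.snd = Q ∧ (∀ᵐ p ∂γ, ‖p.1 - p.2‖ ≤ ρ) ∧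
    v = ((∫ z, f z ∂Q : ℝ) : EReal) - (η : EReal) * (phiDiv φ γ (refMeasure P ρ) : EReal)}

/-- The gap between the regularized robust loss and the nonrobust loss. -/
def gap (φ : ℝ → ℝ≥0∞) (P : Measure E) (f : E → ℝ) (ρ η : ℝ) : EReal :=
  robustValue φ P f ρ η - ((∫ z, f z ∂P : ℝ) : EReal)

/-- Averaged OCE regularizer; `∇f(z)ᵀ b` is `fderiv ℝ f z b`. -/
def regOCE (φ : ℝ → ℝ≥0∞) (P : Measure E) (f : E → ℝ) (C ρ : ℝ) : EReal :=
  (ρ : EReal) * eexp P fun z => ⨅ μ : ℝ, (μ : EReal) +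
    ((1 / C : ℝ) : EReal) * eexp (unifBall 1 (0 : E)) fun b => conj φ (C * (fderiv ℝ f z b - μ))

/-- Gradient norm regularizer; the dual norm of the gradient is the operator norm of the
derivative. -/
def regNorm (P : Measure E) (f : E → ℝ) (ρ : ℝ) : ℝ :=
  ρ * ∫ z, ‖fderiv ℝ f z‖ ∂P

/-- Gradient variance regularizer, where `φ''(1)` is the second derivative at `1` of the real
valued function that `φ` is near `1`. -/
def regVar (φ : ℝ → ℝ≥0∞) (P : Measure E) (f : E → ℝ) (ρ η : ℝ) : ℝ :=
  ρ ^ 2 / (2 * η * iteratedDeriv 2 (fun t => (φ t).toReal) 1) *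
    ∫ z, variance (fun b => fderiv ℝ f z b) (unifBall 1 (0 : E)) ∂P

end Space

/-- `|A - B| = o(ρ)` along `l` for extended real `A`, `B` and positive `ρ`. The absolute value of
an infinite extended real is `∞`, and `⊤ - ⊤ = ⊥` in `EReal`, so that `A` and `B` are in
particular eventually finite. -/
def GapIsLittleO {ι : Type*} (l : Filter ι) (A B : ι → EReal) (ρ : ι → ℝ) : Prop :=
  ∀ ε : ℝ, 0 < ε → ∀ᶠ i in l, (A i - B i).abs ≤ ENNReal.ofReal (ε * ρ i)

end RobustReg

end

/-!
Write `c = ρ / η`, let `β` be the uniform distribution on the unit ball, and for a functional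
`g` let `T(g)` (`tiltValue`) be the supremum of `E_β[g(b) h(b) - φ(h(b))]` over simple
probability densities `h` with respect to `β`. The theorem is a consequence of three facts.

*Reduction to `T`* (`exists_gap_eq`). A coupling of finite divergence has a density with respect
to `γ₀`, and `γ₀` is the image of `P ⊗ β` under `(z, b) ↦ (z, z + ρ b)`. The marginal condition
says that the density is, for almost every `z`, a probability density in `b`. Replacing `f(z + ρ
b)` by `f(z) + ρ ∇f(z)ᵀ b` costs at most `ρ² E|S|`, and the linearized problem separates over
`z`: its value is `E_P[f] + η E_P[T(c ∇f(z))]`. The bound from above is weak duality for each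
`z` (`payoff_le_tiltValue_of_density`). The bound from below takes near-optimal densities from a
countable family, which is possible measurably because `T` is 1-Lipschitz
(`exists_measurable_selection`). Hence the gap is `ρ E_P[T(c ∇f(z)) / c] + O(ρ²)`.

*Strong duality* (`exists_dual_minimizer`, `oce_eq_tiltValue`). The optimized certainty
equivalent `inf_μ {μ + (1/C) E_β[φ*(C(g(b) - μ))]}` equals `T(C g) / C`. If `1` is interior to
the domain of `φ`, a supergradient at mean `1` of the best payoff as a function of the mean of
`h` is an optimal `μ`; supremum and expectation are exchanged by monotone convergence along a
countable family of affine minorants of `φ*`. Otherwise `φ*(s) = s` on a half line, and both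
sides vanish.

*Asymptotics of `T(c g) / c`, which lies in `[0, ‖g‖]`.* It is continuous in `c`, it tends to
`‖g‖` as `c → ∞` when `φ` is finite on `(0, ∞)` (`tendsto_tiltValue_atTop`: densities
concentrated near a maximizer of `g`), and it tends to `0` as `c → 0` when `1` is the only zero
of `φ` (`tendsto_tiltValue_zero`). Dominated convergence, with bound `‖∇f(z)‖`, passes these
limits to the mean. In the third regime the variance term is `ρ` times a constant multiple of
`c`, so that it is `o(ρ)` just as the gap is.
-/

namespace RobustReg

/-! ### Uniform distributions on balls -/

theorem norm_apply_le_of_norm_le_one {E : Type*} [NormedAddCommGroup E] [NormedSpace ℝ E]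
    (g : E →L[ℝ] ℝ) {b : E} (hb : ‖b‖ ≤ 1) : ‖g b‖ ≤ ‖g‖ :=
  (g.le_opNorm b).trans (mul_le_of_le_one_right (norm_nonneg g) hb)

section Ball

variable {E : Type*} [NormedAddCommGroup E] [NormedSpace ℝ E] [FiniteDimensional ℝ E]
  [MeasurableSpace E] [BorelSpace E]

variable (E) in
/-- The uniform distribution on the closed unit ball. -/
noncomputable abbrev unitUnif : Measure E := unifBall 1 (0 : E)

theorem isProbabilityMeasure_unifBall {ρ : ℝ} (hρ : 0 < ρ) (z : E) :
    IsProbabilityMeasure (unifBall ρ z) :=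
  cond_isProbabilityMeasure_of_finite (Metric.measure_closedBall_pos _ z hρ).ne'
    measure_closedBall_lt_top.ne

instance : IsProbabilityMeasure (unitUnif E) := isProbabilityMeasure_unifBall one_pos 0

theorem ae_norm_le_one_unitUnif : ∀ᵐ b ∂(unitUnif E), ‖b‖ ≤ 1 := by
  have := ae_cond_mem (μ := (Measure.addHaar : Measure E))
    (Metric.isClosed_closedBall (x := (0 : E)) (ε := 1)).measurableSet
  filter_upwards [this] with b hb
  simpa using hb

/-- A ball of radius `|r|` is an affine image of the unit ball, compatibly with the uniform
distributions; `r = -1` gives the symmetry of the unit ball. -/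
theorem unifBall_eq_map {r : ℝ} (hr : r ≠ 0) (z : E) :
    unifBall |r| z = (unitUnif E).map (fun b => z + r • b) := by
  have hmeas : Measurable fun b : E => z + r • b := by fun_prop
  have key : ∀ s : Set E, (Measure.addHaar : Measure E) ((fun b : E => z + r • b) ⁻¹' s) =
      ENNReal.ofReal |(r ^ Module.finrank ℝ E)⁻¹| * (Measure.addHaar : Measure E) s := by
    intro s
    have : (fun b : E => z + r • b) ⁻¹' s = (fun b : E => r • b) ⁻¹' ((fun b => z + b) ⁻¹' s) :=
      rfl
    rw [this, Measure.addHaar_preimage_smul _ hr, measure_preimage_add]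
  have hball : (fun b : E => z + r • b) ⁻¹' Metric.closedBall z |r| = Metric.closedBall 0 1 := by
    ext b
    simp [norm_smul, abs_pos.2 hr]
  ext s hs
  rw [Measure.map_apply hmeas hs, unifBall, unitUnif, unifBall,
    cond_apply Metric.isClosed_closedBall.measurableSet,
    cond_apply Metric.isClosed_closedBall.measurableSet, ← hball, ← Set.preimage_inter, key, key]
  have h0 : ENNReal.ofReal |(r ^ Module.finrank ℝ E)⁻¹| ≠ 0 := by
    simp [hr]
  rw [ENNReal.mul_inv (Or.inl h0) (Or.inl ENNReal.ofReal_ne_top), mul_mul_mul_comm,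
    ENNReal.inv_mul_cancel h0 ENNReal.ofReal_ne_top, one_mul]

theorem ae_norm_apply_le (g : E →L[ℝ] ℝ) : ∀ᵐ b ∂(unitUnif E), ‖g b‖ ≤ ‖g‖ := by
  filter_upwards [ae_norm_le_one_unitUnif] with b hb using norm_apply_le_of_norm_le_one g hb

theorem integrable_apply_unitUnif (g : E →L[ℝ] ℝ) : Integrable (fun b => g b) (unitUnif E) :=
  Integrable.of_bound (by fun_prop) ‖g‖ (ae_norm_apply_le g)

theorem integral_apply_unitUnif (g : E →L[ℝ] ℝ) : ∫ b, g b ∂(unitUnif E) = 0 := by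
  have h := unifBall_eq_map (E := E) (r := -1) (by norm_num) 0
  have h1 : ∫ b, g b ∂(unitUnif E) = ∫ b, g (0 + (-1 : ℝ) • b) ∂(unitUnif E) := by
    conv_lhs => rw [show unitUnif E = unifBall |(-1 : ℝ)| 0 by simp [unitUnif], h]
    exact integral_map (by fun_prop) (by fun_prop)
  have h2 : ∫ b, g (0 + (-1 : ℝ) • b) ∂(unitUnif E) = -∫ b, g b ∂(unitUnif E) := by
    rw [← integral_neg]
    simp
  linarith

/-- The kernel measure `P ⊗ ν` in polar form: `(z, b) ↦ (z, z + ρ b)` carries the product of `P`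
with the uniform distribution on the unit ball to it. -/
theorem refMeasure_eq_map (P : Measure E) [SFinite P] {ρ : ℝ} (hρ : 0 < ρ) :
    refMeasure P ρ = (P.prod (unitUnif E)).map (fun p => (p.1, p.1 + ρ • p.2)) := by
  have hm : Measurable fun p : E × E => (p.1, p.1 + ρ • p.2) := by fun_prop
  ext s hs
  rw [refMeasure, Measure.compProd_apply hs, Measure.map_apply hm hs,
    Measure.prod_apply (hm hs)]
  refine lintegral_congr fun z => ?_
  change unifBall ρ z _ = _
  have := unifBall_eq_map hρ.ne' z
  rw [abs_of_pos hρ] at this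
  rw [this, Measure.map_apply (by fun_prop) (measurable_prodMk_left hs)]
  rfl

theorem isProbabilityMeasure_refMeasure (P : Measure E) [IsProbabilityMeasure P] {ρ : ℝ}
    (hρ : 0 < ρ) : IsProbabilityMeasure (refMeasure P ρ) := by
  rw [refMeasure_eq_map P hρ]
  exact Measure.isProbabilityMeasure_map (by fun_prop)

end Ball

/-! ### Divergence functions -/

section Divergence

variable {φ : ℝ → ℝ≥0∞}

theorem IsDivergenceFunction.measurable (hφ : IsDivergenceFunction φ) : Measurable φ :=
  hφ.lsc.measurable

theorem IsDivergenceFunction.nonneg_of_lt_top (hφ : IsDivergenceFunction φ) {t : ℝ}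
    (ht : φ t < ⊤) : 0 ≤ t := by
  by_contra h
  exact ht.ne (hφ.neg t (not_le.1 h))

theorem IsDivergenceFunction.convex_le (hφ : IsDivergenceFunction φ) (x y : ℝ) {a b : ℝ}
    (ha : 0 ≤ a) (hb : 0 ≤ b) (hab : a + b = 1) :
    φ (a * x + b * y) ≤ ENNReal.ofReal a * φ x + ENNReal.ofReal b * φ y := by
  have := hφ.convex.2 (Set.mem_univ x) (Set.mem_univ y) (zero_le (a := a.toNNReal))
    (zero_le (a := b.toNNReal)) (by rw [← Real.toNNReal_add ha hb, hab]; simp)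
  simpa only [NNReal.smul_def, smul_eq_mul, Real.coe_toNNReal _ ha, Real.coe_toNNReal _ hb,
    ENNReal.smul_def, ENNReal.ofNNReal_toNNReal] using this

theorem IsDivergenceFunction.convex_lt_top (hφ : IsDivergenceFunction φ) {x y : ℝ} {a b : ℝ}
    (ha : 0 ≤ a) (hb : 0 ≤ b) (hab : a + b = 1) (hx : φ x < ⊤) (hy : φ y < ⊤) :
    φ (a * x + b * y) < ⊤ :=
  (hφ.convex_le x y ha hb hab).trans_lt (ENNReal.add_lt_top.2
    ⟨ENNReal.mul_lt_top ENNReal.ofReal_lt_top hx, ENNReal.mul_lt_top ENNReal.ofReal_lt_top hy⟩)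

theorem IsDivergenceFunction.convex_toReal_le (hφ : IsDivergenceFunction φ) {x y : ℝ} {a b : ℝ}
    (ha : 0 ≤ a) (hb : 0 ≤ b) (hab : a + b = 1) (hx : φ x < ⊤) (hy : φ y < ⊤) :
    (φ (a * x + b * y)).toReal ≤ a * (φ x).toReal + b * (φ y).toReal := by
  have h1 := ENNReal.mul_ne_top (ENNReal.ofReal_ne_top (r := a)) hx.ne
  have h2 := ENNReal.mul_ne_top (ENNReal.ofReal_ne_top (r := b)) hy.ne
  have := ENNReal.toReal_mono (ENNReal.add_ne_top.2 ⟨h1, h2⟩) (hφ.convex_le x y ha hb hab)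
  rwa [ENNReal.toReal_add h1 h2, ENNReal.toReal_mul, ENNReal.toReal_mul,
    ENNReal.toReal_ofReal ha, ENNReal.toReal_ofReal hb] at this

theorem le_conj {t : ℝ} (ht : φ t < ⊤) (s : ℝ) :
    ((s * t - (φ t).toReal : ℝ) : EReal) ≤ conj φ s := by
  refine le_trans (le_of_eq ?_) (le_iSup (fun t : ℝ => ((s * t : ℝ) : EReal) - (φ t : EReal)) t)
  rw [EReal.coe_sub, EReal.coe_ennreal_toReal ht.ne]

theorem conj_le {s : ℝ} {x : EReal}
    (h : ∀ t, φ t < ⊤ → ((s * t - (φ t).toReal : ℝ) : EReal) ≤ x) : conj φ s ≤ x := by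
  refine iSup_le fun t => ?_
  by_cases ht : φ t < ⊤
  · refine le_trans (le_of_eq ?_) (h t ht)
    rw [EReal.coe_sub, EReal.coe_ennreal_toReal ht.ne]
  · rw [not_lt_top_iff.1 ht]
    simp

/-- The supremum defining the conjugate may be taken over a countable set. -/
theorem IsDivergenceFunction.exists_seq_conj_eq (hφ : IsDivergenceFunction φ) :
    ∃ t : ℕ → ℝ, t 0 = 1 ∧ (∀ n, φ (t n) < ⊤) ∧
      ∀ s : ℝ, conj φ s = ⨆ n, ((s * t n - (φ (t n)).toReal : ℝ) : EReal) := by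
  -- A countable dense subset of the graph of `φ` over its domain suffices.
  let G : Set (ℝ × ℝ) := {p | φ p.1 < ⊤ ∧ p.2 = (φ p.1).toReal}
  have hne : Nonempty G := ⟨⟨(1, 0), by simp [G, hφ.one]⟩⟩
  let d := TopologicalSpace.denseSeq G
  have hd : DenseRange d := TopologicalSpace.denseRange_denseSeq G
  let t : ℕ → ℝ := fun n => Nat.casesOn n 1 fun k => (d k).1.1
  have ht : ∀ n, φ (t n) < ⊤ := by
    rintro (_ | k)
    · simp [t, hφ.one]
    · exact (d k).2.1
  refine ⟨t, rfl, ht, fun s => le_antisymm (conj_le fun u hu => ?_)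
    (iSup_le fun n => le_conj (ht n) s)⟩
  refine le_of_forall_lt fun x hx => ?_
  induction x with
  | top => exact absurd hx not_top_lt
  | bot =>
    exact (EReal.bot_lt_coe _).trans_le
      (le_iSup (fun n => ((s * t n - (φ (t n)).toReal : ℝ) : EReal)) 0)
  | coe x =>
    have hopen : IsOpen {p : G | x < s * p.1.1 - p.1.2} :=
      isOpen_lt continuous_const (by fun_prop)
    obtain ⟨k, hk⟩ := hd.exists_mem_open hopen
      ⟨⟨(u, (φ u).toReal), hu, rfl⟩, EReal.coe_lt_coe_iff.1 hx⟩
    refine (EReal.coe_lt_coe_iff.2 ?_).trans_le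
      (le_iSup (fun n => ((s * t n - (φ (t n)).toReal : ℝ) : EReal)) (k + 1))
    have h2 : (d k).1.2 = (φ (d k).1.1).toReal := (d k).2.2
    change x < s * (d k).1.1 - (φ (d k).1.1).toReal
    rw [← h2]
    exact hk

end Divergence

/-! ### The tilted value of a linear functional -/

/-- Simple functions with values among the first `n + 1` terms of `t` attain the maximum of
`s t - φ(t)` over these terms. -/
theorem exists_simpleFunc_argmax {E : Type*} [MeasurableSpace E] {s : E → ℝ}
    (hs : Measurable s) (φ : ℝ → ℝ≥0∞) (t : ℕ → ℝ) (n : ℕ) :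
    ∃ h : SimpleFunc E ℝ, ∀ b, (∃ k ≤ n, h b = t k) ∧
      ∀ k ≤ n, s b * t k - (φ (t k)).toReal ≤ s b * h b - (φ (h b)).toReal := by
  induction n with
  | zero => exact ⟨SimpleFunc.const E (t 0), fun b => ⟨⟨0, le_rfl, rfl⟩, by simp⟩⟩
  | succ n ih =>
    obtain ⟨h, hh⟩ := ih
    have hA : MeasurableSet {b | s b * h b - (φ (h b)).toReal <
        s b * t (n + 1) - (φ (t (n + 1))).toReal} :=
      measurableSet_lt ((hs.mul h.measurable).sub (h.map fun t => (φ t).toReal).measurable)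
        ((hs.mul_const _).sub_const _)
    refine ⟨SimpleFunc.piecewise _ hA (SimpleFunc.const E (t (n + 1))) h, fun b => ?_⟩
    obtain ⟨⟨k, hk, hkb⟩, hmax⟩ := hh b
    rw [SimpleFunc.piecewise_apply]
    split_ifs with hb
    · refine ⟨⟨n + 1, le_rfl, rfl⟩, fun j hj => ?_⟩
      rcases hj.lt_or_eq with hj | rfl
      · exact (hmax j (by omega)).trans (le_of_lt hb)
      · exact le_rfl
    · refine ⟨⟨k, by omega, hkb⟩, fun j hj => ?_⟩
      rcases hj.lt_or_eq with hj | rfl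
      · exact hmax j (by omega)
      · exact not_lt.1 hb

section Tilt

variable {E : Type*} [NormedAddCommGroup E] [NormedSpace ℝ E] [FiniteDimensional ℝ E]
  [MeasurableSpace E] [BorelSpace E]

/-- Regularized payoff `E_b[g(b) h(b) - φ(h(b))]` of a simple density `h` on the unit ball. It is
meaningful when `φ` is finite on the values of `h`. -/
noncomputable def payoff (φ : ℝ → ℝ≥0∞) (g : E →L[ℝ] ℝ) (h : SimpleFunc E ℝ) : ℝ :=
  ∫ b, (g b * h b - (φ (h b)).toReal) ∂(unitUnif E)

/-- Simple probability densities with respect to the uniform distribution on the unit ball, with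
values in the domain of `φ` (in particular nonnegative). -/
structure IsDensity (φ : ℝ → ℝ≥0∞) (h : SimpleFunc E ℝ) : Prop where
  lt_top : ∀ b, φ (h b) < ⊤
  integral_eq_one : ∫ b, h b ∂(unitUnif E) = 1

/-- The largest regularized payoff `T(g)` over simple probability densities on the unit ball. It
is the optimized certainty equivalent of `g(b)`, in primal form. -/
noncomputable def tiltValue (φ : ℝ → ℝ≥0∞) (g : E →L[ℝ] ℝ) : ℝ :=
  sSup {v | ∃ h : SimpleFunc E ℝ, IsDensity φ h ∧ v = payoff φ g h}

variable {φ : ℝ → ℝ≥0∞}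

theorem integrable_apply_mul_simpleFunc (g : E →L[ℝ] ℝ) (h : SimpleFunc E ℝ) :
    Integrable (fun b => g b * h b) (unitUnif E) := by
  obtain ⟨C, hC⟩ := h.exists_forall_norm_le
  exact (integrable_apply_unitUnif g).mul_bdd h.measurable.aestronglyMeasurable
    (Eventually.of_forall hC)

variable (φ) in
theorem integrable_toReal_comp_simpleFunc (h : SimpleFunc E ℝ) :
    Integrable (fun b => (φ (h b)).toReal) (unitUnif E) :=
  (h.map fun t => (φ t).toReal).integrable_of_isFiniteMeasure

variable (φ) in
theorem integrable_payoff (g : E →L[ℝ] ℝ) (h : SimpleFunc E ℝ) :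
    Integrable (fun b => g b * h b - (φ (h b)).toReal) (unitUnif E) :=
  (integrable_apply_mul_simpleFunc g h).sub (integrable_toReal_comp_simpleFunc φ h)

variable (φ) in
theorem payoff_eq (g : E →L[ℝ] ℝ) (h : SimpleFunc E ℝ) :
    payoff φ g h = (∫ b, g b * h b ∂(unitUnif E)) - ∫ b, (φ (h b)).toReal ∂(unitUnif E) :=
  integral_sub (integrable_apply_mul_simpleFunc g h) (integrable_toReal_comp_simpleFunc φ h)

theorem isDensity_const_one (hφ : IsDivergenceFunction φ) :
    IsDensity φ (SimpleFunc.const E (1 : ℝ)) :=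
  ⟨fun b => by simp [hφ.one], by simp⟩

theorem payoff_const_one (hφ : IsDivergenceFunction φ) (g : E →L[ℝ] ℝ) :
    payoff φ g (SimpleFunc.const E (1 : ℝ)) = 0 := by
  simp [payoff, hφ.one, integral_apply_unitUnif]

theorem IsDensity.integral_mul_le (hφ : IsDivergenceFunction φ) {h : SimpleFunc E ℝ}
    (hh : IsDensity φ h) (g : E →L[ℝ] ℝ) : ∫ b, g b * h b ∂(unitUnif E) ≤ ‖g‖ := by
  have : ∫ b, g b * h b ∂(unitUnif E) ≤ ∫ b, ‖g‖ * h b ∂(unitUnif E) := by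
    refine integral_mono_ae (integrable_apply_mul_simpleFunc g h)
      (h.integrable_of_isFiniteMeasure.const_mul _) ?_
    filter_upwards [ae_norm_apply_le g] with b hb
    exact mul_le_mul_of_nonneg_right ((le_abs_self _).trans hb) (hφ.nonneg_of_lt_top (hh.lt_top b))
  rwa [integral_const_mul, hh.integral_eq_one, mul_one] at this

theorem IsDensity.payoff_le_norm_sub (hφ : IsDivergenceFunction φ) {h : SimpleFunc E ℝ}
    (hh : IsDensity φ h) (g : E →L[ℝ] ℝ) :
    payoff φ g h ≤ ‖g‖ - ∫ b, (φ (h b)).toReal ∂(unitUnif E) := by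
  rw [payoff_eq]
  exact sub_le_sub_right (hh.integral_mul_le hφ g) _

theorem IsDensity.payoff_le_norm (hφ : IsDivergenceFunction φ) {h : SimpleFunc E ℝ}
    (hh : IsDensity φ h) (g : E →L[ℝ] ℝ) : payoff φ g h ≤ ‖g‖ :=
  (hh.payoff_le_norm_sub hφ g).trans
    (sub_le_self _ (integral_nonneg fun _ => ENNReal.toReal_nonneg))

theorem IsDensity.payoff_le_tiltValue (hφ : IsDivergenceFunction φ) {h : SimpleFunc E ℝ}
    (hh : IsDensity φ h) (g : E →L[ℝ] ℝ) : payoff φ g h ≤ tiltValue φ g := by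
  refine le_csSup ⟨‖g‖, ?_⟩ ⟨h, hh, rfl⟩
  rintro _ ⟨k, hk, rfl⟩
  exact hk.payoff_le_norm hφ g

theorem tiltValue_le (hφ : IsDivergenceFunction φ) {g : E →L[ℝ] ℝ} {a : ℝ}
    (ha : ∀ h, IsDensity φ h → payoff φ g h ≤ a) : tiltValue φ g ≤ a := by
  refine csSup_le ⟨_, _, isDensity_const_one hφ, rfl⟩ ?_
  rintro _ ⟨k, hk, rfl⟩
  exact ha k hk

theorem exists_lt_payoff (hφ : IsDivergenceFunction φ) {g : E →L[ℝ] ℝ} {a : ℝ}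
    (ha : a < tiltValue φ g) : ∃ h, IsDensity φ h ∧ a < payoff φ g h := by
  by_contra! hc
  exact ha.not_ge (tiltValue_le hφ hc)

theorem tiltValue_nonneg (hφ : IsDivergenceFunction φ) (g : E →L[ℝ] ℝ) : 0 ≤ tiltValue φ g :=
  (payoff_const_one hφ g).ge.trans ((isDensity_const_one hφ).payoff_le_tiltValue hφ g)

theorem tiltValue_le_norm (hφ : IsDivergenceFunction φ) (g : E →L[ℝ] ℝ) :
    tiltValue φ g ≤ ‖g‖ :=
  tiltValue_le hφ fun _ hh => hh.payoff_le_norm hφ g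

theorem IsDensity.payoff_le_add (hφ : IsDivergenceFunction φ) {h : SimpleFunc E ℝ}
    (hh : IsDensity φ h) (g g' : E →L[ℝ] ℝ) : payoff φ g h ≤ payoff φ g' h + ‖g - g'‖ := by
  have h1 := hh.integral_mul_le hφ (g - g')
  simp only [_root_.sub_apply, sub_mul] at h1
  rw [integral_sub (integrable_apply_mul_simpleFunc g h) (integrable_apply_mul_simpleFunc g' h)]
    at h1
  rw [payoff_eq, payoff_eq]
  linarith

theorem tiltValue_le_add (hφ : IsDivergenceFunction φ) (g g' : E →L[ℝ] ℝ) :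
    tiltValue φ g ≤ tiltValue φ g' + ‖g - g'‖ :=
  tiltValue_le hφ fun _ hh => (hh.payoff_le_add hφ g g').trans
    (by gcongr; exact hh.payoff_le_tiltValue hφ g')

theorem abs_tiltValue_sub_le (hφ : IsDivergenceFunction φ) (g g' : E →L[ℝ] ℝ) :
    |tiltValue φ g - tiltValue φ g'| ≤ ‖g - g'‖ := by
  have h1 := tiltValue_le_add hφ g g'
  have h2 := tiltValue_le_add hφ g' g
  rw [norm_sub_rev] at h2
  exact abs_sub_le_iff.2 ⟨by linarith, by linarith⟩

theorem continuous_tiltValue (hφ : IsDivergenceFunction φ) :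
    Continuous (tiltValue φ : (E →L[ℝ] ℝ) → ℝ) :=
  (LipschitzWith.of_dist_le_mul (K := 1) fun g g' => by
    simpa [Real.dist_eq, dist_eq_norm] using abs_tiltValue_sub_le hφ g g').continuous

/-! ### Strong duality -/

/-- A mixture of simple functions of mean below and above one, so weighted as to have mean one,
is a density. Concavity of the payoff gives the stated bound. -/
theorem mixture_payoff_le (hφ : IsDivergenceFunction φ) (g : E →L[ℝ] ℝ) {h k : SimpleFunc E ℝ}
    (hh : ∀ b, φ (h b) < ⊤) (hk : ∀ b, φ (k b) < ⊤) {x y : ℝ} (hx : 0 ≤ x) (hy : 0 ≤ y)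
    (hxy : x + y = 1)
    (hmean : x * ∫ b, h b ∂(unitUnif E) + y * ∫ b, k b ∂(unitUnif E) = 1) :
    x * payoff φ g h + y * payoff φ g k ≤ tiltValue φ g := by
  have hih := h.integrable_of_isFiniteMeasure (μ := unitUnif E)
  have hik := k.integrable_of_isFiniteMeasure (μ := unitUnif E)
  let m : SimpleFunc E ℝ := (h.map (x * ·)) + (k.map (y * ·))
  have hm : ∀ b, m b = x * h b + y * k b := fun b => rfl
  have hmd : IsDensity φ m := by
    refine ⟨fun b => ?_, ?_⟩
    · rw [hm]
      exact hφ.convex_lt_top hx hy hxy (hh b) (hk b)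
    · simp only [hm]
      rw [integral_add (hih.const_mul x) (hik.const_mul y), integral_const_mul,
        integral_const_mul, hmean]
  refine le_trans ?_ (hmd.payoff_le_tiltValue hφ g)
  unfold payoff
  rw [← integral_const_mul, ← integral_const_mul, ← integral_add
    ((integrable_payoff φ g h).const_mul x) ((integrable_payoff φ g k).const_mul y)]
  refine integral_mono (((integrable_payoff φ g h).const_mul x).add
    ((integrable_payoff φ g k).const_mul y)) (integrable_payoff φ g m) fun b => ?_
  have := hφ.convex_toReal_le hx hy hxy (hh b) (hk b)
  simp only [hm]
  linarith

/-- The Lagrange multiplier of the constraint that a density has mean one: a supergradient at `1`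
of the concave function sending `m` to the best payoff of mean `m`. It exists when `1` is interior
to the domain of `φ`. -/
theorem exists_multiplier (hφ : IsDivergenceFunction φ) (g : E →L[ℝ] ℝ) {p q : ℝ} (hp : p < 1)
    (hφp : φ p < ⊤) (hq : 1 < q) (hφq : φ q < ⊤) :
    ∃ μ : ℝ, ∀ h : SimpleFunc E ℝ, (∀ b, φ (h b) < ⊤) →
      payoff φ g h ≤ tiltValue φ g + μ * ((∫ b, h b ∂(unitUnif E)) - 1) := by
  let A : Set ℝ := {r | ∃ h : SimpleFunc E ℝ, (∀ b, φ (h b) < ⊤) ∧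
    1 < ∫ b, h b ∂(unitUnif E) ∧
    r = (payoff φ g h - tiltValue φ g) / ((∫ b, h b ∂(unitUnif E)) - 1)}
  have hslope : ∀ r ∈ A, ∀ k : SimpleFunc E ℝ, (∀ b, φ (k b) < ⊤) →
      ∫ b, k b ∂(unitUnif E) < 1 →
      r ≤ (tiltValue φ g - payoff φ g k) / (1 - ∫ b, k b ∂(unitUnif E)) := by
    rintro _ ⟨h, hh, hm, rfl⟩ k hk hkm
    set m := ∫ b, h b ∂(unitUnif E)
    set n := ∫ b, k b ∂(unitUnif E)
    have hmn : 0 < m - n := by linarith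
    have := mixture_payoff_le hφ g hh hk (x := (1 - n) / (m - n)) (y := (m - 1) / (m - n))
      (div_nonneg (by linarith) hmn.le) (div_nonneg (by linarith) hmn.le)
      (by field_simp; ring) (by change _ * m + _ * n = 1; field_simp; ring)
    rw [div_mul_eq_mul_div, div_mul_eq_mul_div, ← add_div, div_le_iff₀ hmn] at this
    rw [div_le_div_iff₀ (by linarith) (by linarith)]
    linarith
  have hAne : A.Nonempty := ⟨_, SimpleFunc.const E q, fun b => by simpa using hφq,
    by simpa using hq, rfl⟩
  have hAbdd : BddAbove A := ⟨_, fun r hr => hslope r hr (SimpleFunc.const E p)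
    (fun b => by simpa using hφp) (by simpa using hp)⟩
  refine ⟨sSup A, fun h hh => ?_⟩
  rcases lt_trichotomy (∫ b, h b ∂(unitUnif E)) 1 with hlt | heq | hgt
  · have := csSup_le hAne fun r hr => hslope r hr h hh hlt
    rw [le_div_iff₀ (by linarith)] at this
    linarith
  · rw [heq, sub_self, mul_zero, add_zero]
    exact IsDensity.payoff_le_tiltValue hφ ⟨hh, heq⟩ g
  · have := le_csSup hAbdd ⟨h, hh, hgt, rfl⟩
    rw [div_le_iff₀ (by linarith)] at this
    linarith

/-- Strong duality: the dual problem has a minimizer `μ`, at which the conjugate is almost surely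
finite and integrable, and the minimum does not exceed `T(g)`. -/
theorem exists_dual_minimizer (hφ : IsDivergenceFunction φ) (g : E →L[ℝ] ℝ) :
    ∃ (μ : ℝ) (u : E → ℝ), Integrable u (unitUnif E) ∧
      (∀ᵐ b ∂(unitUnif E), conj φ (g b - μ) = u b) ∧
      μ + ∫ b, u b ∂(unitUnif E) ≤ tiltValue φ g := by
  have hbdry : ∀ μ : ℝ, (∀ᵐ b ∂(unitUnif E), conj φ (g b - μ) ≤ ((g b - μ : ℝ) : EReal)) →
      ∃ (μ : ℝ) (u : E → ℝ), Integrable u (unitUnif E) ∧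
      (∀ᵐ b ∂(unitUnif E), conj φ (g b - μ) = u b) ∧
      μ + ∫ b, u b ∂(unitUnif E) ≤ tiltValue φ g := by
    intro μ hμ
    refine ⟨μ, fun b => g b - μ, (integrable_apply_unitUnif g).sub (integrable_const μ), ?_, ?_⟩
    · filter_upwards [hμ] with b hb
      refine le_antisymm hb ?_
      have := le_conj (φ := φ) (t := 1) (by simp [hφ.one]) (g b - μ)
      simpa [hφ.one] using this
    · rw [integral_sub (integrable_apply_unitUnif g) (integrable_const μ),
        integral_apply_unitUnif]
      simpa using tiltValue_nonneg hφ g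
  by_cases hp : ∃ p < 1, φ p < ⊤
  swap
  · -- The domain lies in `[1, ∞)`, so that `φ*(s) = s` for `s ≤ 0`.
    push Not at hp
    refine hbdry ‖g‖ ?_
    filter_upwards [ae_norm_apply_le g] with b hb
    refine conj_le fun t ht => EReal.coe_le_coe_iff.2 ?_
    have ht1 : 1 ≤ t := by
      by_contra hc
      exact (hp t (not_le.1 hc)).not_gt ht
    have h1 : g b ≤ ‖g‖ := (le_abs_self _).trans hb
    have h2 : 0 ≤ (φ t).toReal := ENNReal.toReal_nonneg
    nlinarith
  by_cases hq : ∃ q > 1, φ q < ⊤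
  swap
  · -- The domain lies in `[0, 1]`, so that `φ*(s) = s` for `s ≥ 0`.
    push Not at hq
    refine hbdry (-‖g‖) ?_
    filter_upwards [ae_norm_apply_le g] with b hb
    refine conj_le fun t ht => EReal.coe_le_coe_iff.2 ?_
    have ht1 : t ≤ 1 := by
      by_contra hc
      exact (hq t (not_le.1 hc)).not_gt ht
    have h1 : -‖g‖ ≤ g b := (abs_le.1 hb).1
    have h2 : 0 ≤ (φ t).toReal := ENNReal.toReal_nonneg
    nlinarith
  obtain ⟨p, hp1, hp⟩ := hp
  obtain ⟨q, hq1, hq⟩ := hq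
  obtain ⟨μ, hμ⟩ := exists_multiplier hφ g hp1 hp hq1 hq
  obtain ⟨t, ht0, ht, hconj⟩ := hφ.exists_seq_conj_eq
  have hsm : Measurable fun b : E => g b - μ := g.continuous.measurable.sub_const μ
  choose h hh using exists_simpleFunc_argmax hsm φ t
  -- `w n b` is the maximum of the first `n + 1` affine minorants of `φ*` at `g b - μ`.
  let w : ℕ → E → ℝ := fun n b => (g b - μ) * h n b - (φ (h n b)).toReal
  have hdom : ∀ n b, φ (h n b) < ⊤ := fun n b => by
    obtain ⟨k, -, hk⟩ := (hh n b).1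
    rw [hk]
    exact ht k
  have hw_eq : ∀ n b, w n b = (g b * h n b - (φ (h n b)).toReal) - μ * h n b := fun n b => by
    simp only [w]; ring
  have hw_int : ∀ n, Integrable (w n) (unitUnif E) := fun n => by
    have := (integrable_payoff φ g (h n)).sub
      (((h n).integrable_of_isFiniteMeasure (μ := unitUnif E)).const_mul μ)
    exact this.congr (Eventually.of_forall fun b => (hw_eq n b).symm)
  have hw_le : ∀ n, ∫ b, w n b ∂(unitUnif E) ≤ tiltValue φ g - μ := fun n => by
    have h1 := hμ (h n) (hdom n)
    have h2 : ∫ b, w n b ∂(unitUnif E) = payoff φ g (h n) - μ * ∫ b, h n b ∂(unitUnif E) := by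
      rw [payoff, ← integral_const_mul, ← integral_sub (integrable_payoff φ g (h n))
        (((h n).integrable_of_isFiniteMeasure (μ := unitUnif E)).const_mul μ)]
      exact integral_congr_ae (Eventually.of_forall fun b => hw_eq n b)
    linarith
  have hw_ge : ∀ n b, ∀ k ≤ n, (g b - μ) * t k - (φ (t k)).toReal ≤ w n b :=
    fun n b => (hh n b).2
  have hw_conj : ∀ n b, ((w n b : ℝ) : EReal) ≤ conj φ (g b - μ) := fun n b =>
    le_conj (hdom n b) _
  have hw_mono : ∀ b, Monotone fun n => w n b := fun b n m hnm => by
    obtain ⟨k, hk, hkb⟩ := (hh n b).1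
    have := hw_ge m b k (hk.trans hnm)
    simpa only [w, hkb] using this
  have hw_base : ∀ n b, g b - μ ≤ w n b := fun n b => by
    have := hw_ge n b 0 (Nat.zero_le n)
    simpa [ht0, hφ.one] using this
  have hbase_int : Integrable (fun b => g b - μ) (unitUnif E) :=
    (integrable_apply_unitUnif g).sub (integrable_const μ)
  have hbase : ∫ b, (g b - μ) ∂(unitUnif E) = -μ := by
    rw [integral_sub (integrable_apply_unitUnif g) (integrable_const μ), integral_apply_unitUnif]
    simp
  let F : E → ℝ≥0∞ := fun b => ⨆ n, ENNReal.ofReal (w n b - (g b - μ))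
  have hw_meas : ∀ n, Measurable (w n) := fun n =>
    (hsm.mul (h n).measurable).sub ((h n).map fun t => (φ t).toReal).measurable
  have hF_meas : Measurable F := Measurable.iSup fun n => ((hw_meas n).sub hsm).ennreal_ofReal
  have hF : ∫⁻ b, F b ∂(unitUnif E) ≤ ENNReal.ofReal (tiltValue φ g) := by
    rw [show ∫⁻ b, F b ∂(unitUnif E) = ⨆ n, ∫⁻ b, ENNReal.ofReal (w n b - (g b - μ)) ∂(unitUnif E)
      from lintegral_iSup (fun n => ((hw_meas n).sub hsm).ennreal_ofReal)
      (fun n m hnm b => ENNReal.ofReal_le_ofReal (sub_le_sub_right (hw_mono b hnm) _))]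
    refine iSup_le fun n => ?_
    have hd : Integrable (fun b => w n b - (g b - μ)) (unitUnif E) := (hw_int n).sub hbase_int
    rw [← ofReal_integral_eq_lintegral_ofReal hd
      (Eventually.of_forall fun b => sub_nonneg.2 (hw_base n b))]
    refine ENNReal.ofReal_le_ofReal ?_
    rw [integral_sub (hw_int n) hbase_int, hbase]
    linarith [hw_le n]
  have hF_top : ∫⁻ b, F b ∂(unitUnif E) ≠ ⊤ := (hF.trans_lt ENNReal.ofReal_lt_top).ne
  refine ⟨μ, fun b => (F b).toReal + (g b - μ),
    (integrable_toReal_of_lintegral_ne_top hF_meas.aemeasurable hF_top).add hbase_int, ?_, ?_⟩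
  · filter_upwards [ae_lt_top hF_meas hF_top] with b hb
    refine le_antisymm ?_ ?_
    · rw [hconj]
      refine iSup_le fun n => EReal.coe_le_coe_iff.2 ?_
      have h1 : w n b - (g b - μ) ≤ (F b).toReal :=
        (ENNReal.ofReal_le_iff_le_toReal hb.ne).1
          (le_iSup (fun n => ENNReal.ofReal (w n b - (g b - μ))) n)
      linarith [hw_ge n b n le_rfl]
    · -- Each `w n b` is a lower bound for the conjugate, hence so is their limit.
      have hlim : Tendsto (fun n => w n b - (g b - μ)) atTop (𝓝 (F b).toReal) := by
        have h1 : Tendsto (fun n => ENNReal.ofReal (w n b - (g b - μ))) atTop (𝓝 (F b)) :=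
          tendsto_atTop_iSup fun n m hnm =>
            ENNReal.ofReal_le_ofReal (sub_le_sub_right (hw_mono b hnm) _)
        have h2 := (ENNReal.tendsto_toReal hb.ne).comp h1
        refine h2.congr fun n => ?_
        exact ENNReal.toReal_ofReal (sub_nonneg.2 (hw_base n b))
      have hlim2 : Tendsto (fun n => ((w n b : ℝ) : EReal)) atTop
          (𝓝 (((F b).toReal + (g b - μ) : ℝ) : EReal)) := by
        refine (continuous_coe_real_ereal.tendsto _).comp ?_
        simpa using hlim.add_const (g b - μ)
      exact le_of_tendsto' hlim2 fun n => hw_conj n b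
  · rw [integral_add (integrable_toReal_of_lintegral_ne_top hF_meas.aemeasurable hF_top)
      hbase_int, hbase, integral_toReal hF_meas.aemeasurable (ae_lt_top hF_meas hF_top)]
    have := ENNReal.toReal_mono ENNReal.ofReal_ne_top hF
    rw [ENNReal.toReal_ofReal (tiltValue_nonneg hφ g)] at this
    linarith

end Tilt

/-! ### Expectations of extended real functions -/

section Eexp

variable {Ω : Type*} [MeasurableSpace Ω] {m : Measure Ω}

theorem eexp_mono {u v : Ω → EReal} (h : ∀ᵐ x ∂m, u x ≤ v x) : eexp m u ≤ eexp m v := by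
  refine EReal.sub_le_sub (EReal.coe_ennreal_le_coe_ennreal_iff.2 (lintegral_mono_ae ?_))
    (EReal.coe_ennreal_le_coe_ennreal_iff.2 (lintegral_mono_ae ?_))
  · filter_upwards [h] with x hx using EReal.toENNReal_le_toENNReal hx
  · filter_upwards [h] with x hx using EReal.toENNReal_le_toENNReal (EReal.neg_le_neg_iff.2 hx)

theorem eexp_congr {u v : Ω → EReal} (h : ∀ᵐ x ∂m, u x = v x) : eexp m u = eexp m v :=
  le_antisymm (eexp_mono (h.mono fun _ hx => hx.le)) (eexp_mono (h.mono fun _ hx => hx.ge))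

theorem eexp_coe {u : Ω → ℝ} (hu : Integrable u m) :
    eexp m (fun x => (u x : EReal)) = ((∫ x, u x ∂m : ℝ) : EReal) := by
  rw [eexp, integral_eq_lintegral_pos_part_sub_lintegral_neg_part hu, EReal.coe_sub,
    EReal.coe_ennreal_toReal hu.lintegral_lt_top.ne,
    EReal.coe_ennreal_toReal (show ∫⁻ x, ENNReal.ofReal (-u x) ∂m ≠ ⊤ from
      hu.neg.lintegral_lt_top.ne)]
  simp only [← EReal.coe_neg, EReal.toENNReal_of_ne_top (EReal.coe_ne_top _), EReal.toReal_coe]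

end Eexp

/-! ### The optimized certainty equivalent -/

section Tilt

variable {E : Type*} [NormedAddCommGroup E] [NormedSpace ℝ E] [FiniteDimensional ℝ E]
  [MeasurableSpace E] [BorelSpace E] {φ : ℝ → ℝ≥0∞}

/-- The optimized certainty equivalent, by duality and scaling in `C`. -/
theorem oce_eq_tiltValue (hφ : IsDivergenceFunction φ) (g : E →L[ℝ] ℝ) {C : ℝ} (hC : 0 < C) :
    (⨅ μ : ℝ, (μ : EReal) +
      ((1 / C : ℝ) : EReal) * eexp (unifBall 1 (0 : E)) fun b => conj φ (C * (g b - μ))) =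
      ((tiltValue φ (C • g) / C : ℝ) : EReal) := by
  have hC' : (0 : EReal) ≤ ((1 / C : ℝ) : EReal) := EReal.coe_nonneg.2 (by positivity)
  refine le_antisymm ?_ (le_iInf fun μ => ?_)
  · obtain ⟨μ, u, hu, hconj, hle⟩ := exists_dual_minimizer hφ (C • g)
    refine iInf_le_of_le (μ / C) ?_
    have : eexp (unifBall 1 (0 : E)) (fun b => conj φ (C * (g b - μ / C))) =
        ((∫ b, u b ∂(unitUnif E) : ℝ) : EReal) := by
      rw [← eexp_coe hu]
      refine eexp_congr ?_
      filter_upwards [hconj] with b hb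
      rw [← hb, mul_sub, mul_div_cancel₀ _ hC.ne']
      rfl
    rw [this, ← EReal.coe_mul, ← EReal.coe_add]
    refine EReal.coe_le_coe_iff.2 ?_
    rw [one_div_mul_eq_div, ← add_div]
    gcongr
  · set X := eexp (unifBall 1 (0 : E)) fun b => conj φ (C * (g b - μ)) with hXdef
    have hX : ∀ h, IsDensity φ h → ((payoff φ (C • g) h - C * μ : ℝ) : EReal) ≤ X := by
      intro h hh
      have hint : Integrable (fun b => (C • g) b * h b - (φ (h b)).toReal - C * μ * h b)
          (unitUnif E) :=
        (integrable_payoff φ (C • g) h).sub (h.integrable_of_isFiniteMeasure.const_mul (C * μ))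
      have heq : payoff φ (C • g) h - C * μ = ∫ b,
          ((C • g) b * h b - (φ (h b)).toReal - C * μ * h b) ∂(unitUnif E) := by
        rw [integral_sub (integrable_payoff φ (C • g) h)
          (h.integrable_of_isFiniteMeasure.const_mul (C * μ)), integral_const_mul,
          hh.integral_eq_one, mul_one, payoff]
      rw [heq, ← eexp_coe hint]
      refine eexp_mono (Eventually.of_forall fun b => ?_)
      refine le_trans (EReal.coe_le_coe_iff.2 (le_of_eq ?_))
        (le_conj (hh.lt_top b) (C * (g b - μ)))
      simp only [FunLike.coe_smul, Pi.smul_apply, smul_eq_mul]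
      ring
    have hT : ((tiltValue φ (C • g) - C * μ : ℝ) : EReal) ≤ X := by
      clear_value X
      induction X with
      | top => exact le_top
      | bot => exact absurd (hX _ (isDensity_const_one hφ)) (not_le.2 (EReal.bot_lt_coe _))
      | coe x =>
        refine EReal.coe_le_coe_iff.2 (sub_le_iff_le_add.2 (tiltValue_le hφ fun h hh => ?_))
        exact sub_le_iff_le_add.1 (EReal.coe_le_coe_iff.1 (hX h hh))
    have heq : ((tiltValue φ (C • g) / C : ℝ) : EReal) =
        (μ : EReal) + ((1 / C : ℝ) : EReal) * ((tiltValue φ (C • g) - C * μ : ℝ) : EReal) := by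
      rw [← EReal.coe_mul, ← EReal.coe_add]
      congr 1
      field_simp
      ring
    rw [heq]
    gcongr

/-- Weak duality for an arbitrary density `k`: its regularized payoff is at most `T(g)`. -/
theorem payoff_le_tiltValue_of_density (hφ : IsDivergenceFunction φ) (g : E →L[ℝ] ℝ)
    {k : E → ℝ} (hk : Integrable k (unitUnif E)) (hk1 : ∫ b, k b ∂(unitUnif E) = 1)
    (hφk : ∫⁻ b, φ (k b) ∂(unitUnif E) ≠ ⊤) :
    (∫ b, g b * k b ∂(unitUnif E)) - ∫ b, (φ (k b)).toReal ∂(unitUnif E) ≤ tiltValue φ g := by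
  obtain ⟨μ, u, hu, hconj, hle⟩ := exists_dual_minimizer hφ g
  have hm : AEMeasurable (fun b => φ (k b)) (unitUnif E) :=
    hφ.measurable.comp_aemeasurable hk.aemeasurable
  have hgk : Integrable (fun b => g b * k b) (unitUnif E) :=
    hk.bdd_mul (by fun_prop) (ae_norm_apply_le g)
  have hint : Integrable (fun b => (φ (k b)).toReal) (unitUnif E) :=
    integrable_toReal_of_lintegral_ne_top hm hφk
  have : ∫ b, (g b * k b - (φ (k b)).toReal) ∂(unitUnif E) ≤
      ∫ b, (μ * k b + u b) ∂(unitUnif E) := by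
    refine integral_mono_ae (hgk.sub hint) ((hk.const_mul μ).add hu) ?_
    filter_upwards [hconj, ae_lt_top' hm hφk] with b hb ht
    have := le_conj ht (g b - μ)
    rw [hb, EReal.coe_le_coe_iff] at this
    linarith
  rw [integral_sub hgk hint, integral_add (hk.const_mul μ) hu, integral_const_mul, hk1] at this
  linarith

/-! ### Asymptotics of the tilted value -/

/-- If `φ` is finite on `(0, ∞)`, a density concentrated near a maximizer of `g` on the ball, but
bounded away from zero, has finite divergence. -/
theorem exists_density_near_norm (hfin : ∀ t > 0, φ t < ⊤) (g : E →L[ℝ] ℝ) {ε : ℝ}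
    (hε : 0 < ε) :
    ∃ h : SimpleFunc E ℝ, IsDensity φ h ∧ ‖g‖ - ε ≤ ∫ b, g b * h b ∂(unitUnif E) := by
  let A : Set E := {b | ‖g‖ - ε / 2 < g b}
  have hA : IsOpen A := isOpen_lt continuous_const g.continuous
  have hApos : 0 < (unitUnif E).real A := by
    have hne : (A ∩ Metric.ball 0 1).Nonempty := by
      obtain ⟨x, hx, hxg⟩ := g.exists_lt_apply_of_lt_opNorm (r := ‖g‖ - ε / 2) (by linarith)
      rcases le_total 0 (g x) with h0 | h0
      · exact ⟨x, by simpa [A, Real.norm_of_nonneg h0] using hxg, by simpa using hx⟩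
      · refine ⟨-x, ?_, by simpa using hx⟩
        simpa [A, Real.norm_of_nonpos h0] using hxg
    refine ENNReal.toReal_pos ?_ (measure_ne_top _ _)
    rw [unitUnif, unifBall, cond_apply Metric.isClosed_closedBall.measurableSet]
    refine mul_ne_zero (ENNReal.inv_ne_zero.2 measure_closedBall_lt_top.ne) ?_
    have h1 : 0 < (Measure.addHaar : Measure E) (A ∩ Metric.ball 0 1) :=
      (hA.inter Metric.isOpen_ball).measure_pos _ hne
    refine (h1.trans_le (measure_mono ?_)).ne'
    rintro b ⟨hb1, hb2⟩
    exact ⟨Metric.ball_subset_closedBall hb2, hb1⟩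
  set a := (unitUnif E).real A
  -- The weight `δ` of the uniform density keeps the values positive.
  let δ : ℝ := ε / (2 * (‖g‖ + ε))
  have hgε : 0 < ‖g‖ + ε := by positivity
  have hδ0 : 0 < δ := by positivity
  have hδ1 : δ < 1 := by
    rw [div_lt_one (by positivity)]
    linarith [norm_nonneg g]
  have hδg : δ * ‖g‖ ≤ ε / 2 := by
    rw [div_mul_eq_mul_div, div_le_div_iff₀ (by positivity) (by positivity)]
    nlinarith
  let h : SimpleFunc E ℝ := SimpleFunc.piecewise A hA.measurableSet
    (SimpleFunc.const E (δ + (1 - δ) / a)) (SimpleFunc.const E δ)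
  have hh : ∀ b, h b = δ + A.indicator (fun _ => (1 - δ) / a) b := fun b => by
    simp only [h, SimpleFunc.piecewise_apply, Set.indicator_apply]
    split_ifs <;> simp
  have hquot : 0 < (1 - δ) / a := div_pos (by linarith) hApos
  have hind : Integrable (A.indicator fun _ => (1 - δ) / a) (unitUnif E) :=
    (integrable_const _).indicator hA.measurableSet
  have hind1 : ∫ b, A.indicator (fun _ => (1 - δ) / a) b ∂(unitUnif E) = 1 - δ := by
    rw [integral_indicator hA.measurableSet, setIntegral_const, smul_eq_mul]
    exact mul_div_cancel₀ _ hApos.ne'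
  have hdens : IsDensity φ h := by
    refine ⟨fun b => hfin _ ?_, ?_⟩
    · rw [hh]
      exact add_pos_of_pos_of_nonneg hδ0 (Set.indicator_nonneg (fun _ _ => hquot.le) b)
    · simp only [hh]
      rw [integral_add (integrable_const _) hind, hind1]
      simp
  refine ⟨h, hdens, ?_⟩
  have hmono : ∫ b, (δ * g b + (‖g‖ - ε / 2) * A.indicator (fun _ => (1 - δ) / a) b)
      ∂(unitUnif E) ≤ ∫ b, g b * h b ∂(unitUnif E) := by
    refine integral_mono (((integrable_apply_unitUnif g).const_mul δ).add (hind.const_mul _))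
      (integrable_apply_mul_simpleFunc g h) fun b => ?_
    simp only [hh]
    by_cases hb : b ∈ A
    · rw [Set.indicator_of_mem hb]
      have : ‖g‖ - ε / 2 ≤ g b := le_of_lt hb
      nlinarith
    · rw [Set.indicator_of_notMem hb]
      linarith
  rw [integral_add ((integrable_apply_unitUnif g).const_mul δ) (hind.const_mul _),
    integral_const_mul, integral_const_mul, integral_apply_unitUnif, hind1] at hmono
  nlinarith

theorem tendsto_tiltValue_atTop (hφ : IsDivergenceFunction φ) (hfin : ∀ t > 0, φ t < ⊤)
    (g : E →L[ℝ] ℝ) :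
    Tendsto (fun c : ℝ => tiltValue φ (c • g) / c) atTop (𝓝 ‖g‖) := by
  rw [Metric.tendsto_nhds]
  intro ε hε
  obtain ⟨h, hh, hg⟩ := exists_density_near_norm hfin g (ε := ε / 3) (by positivity)
  set K := ∫ b, (φ (h b)).toReal ∂(unitUnif E)
  filter_upwards [eventually_gt_atTop 0, eventually_ge_atTop (3 * K / ε)] with c hc hcK
  rw [Real.dist_eq, abs_sub_lt_iff]
  constructor
  · have := tiltValue_le_norm hφ (c • g)
    rw [norm_smul, Real.norm_of_nonneg hc.le] at this
    have : tiltValue φ (c • g) / c ≤ ‖g‖ := by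
      rw [div_le_iff₀ hc]; linarith
    linarith
  · have h1 := hh.payoff_le_tiltValue hφ (c • g)
    rw [payoff_eq] at h1
    simp only [FunLike.coe_smul, Pi.smul_apply, smul_eq_mul, mul_assoc] at h1
    rw [integral_const_mul] at h1
    have h2 : c * (‖g‖ - ε / 3) ≤ c * ∫ b, g b * h b ∂(unitUnif E) :=
      mul_le_mul_of_nonneg_left hg hc.le
    have h3 : K ≤ c * (ε / 3) := by
      rw [div_le_iff₀ hε] at hcK
      linarith
    have h4 : ‖g‖ - 2 * ε / 3 ≤ tiltValue φ (c • g) / c := by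
      rw [le_div_iff₀ hc]
      linarith
    linarith

/-- A divergence function with positive second derivative at `1` vanishes only there: otherwise it
would vanish on an interval with endpoint `1`, by convexity. -/
theorem ne_zero_of_iteratedDeriv_pos (hφ : IsDivergenceFunction φ)
    (hC2 : ContDiffAt ℝ 2 (fun t => (φ t).toReal) 1)
    (h2 : 0 < iteratedDeriv 2 (fun t => (φ t).toReal) 1) {t : ℝ} (ht : t ≠ 1) : φ t ≠ 0 := by
  intro h0
  have hz : ∀ a : ℝ, 0 ≤ a → a ≤ 1 → (φ (a * t + (1 - a) * 1)).toReal = 0 := fun a ha0 ha1 => by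
    have := hφ.convex_le t 1 ha0 (sub_nonneg.2 ha1) (by ring)
    rw [h0, hφ.one, mul_zero, mul_zero, add_zero, nonpos_iff_eq_zero] at this
    rw [this, ENNReal.toReal_zero]
  have hcont : ContinuousAt (iteratedDeriv 2 (fun t => (φ t).toReal)) 1 := by
    rw [iteratedDeriv_eq_equiv_comp]
    exact (LinearIsometryEquiv.continuous _).continuousAt.comp
      (hC2.continuousAt_iteratedFDeriv le_rfl)
  have hlim : Tendsto (fun a : ℝ => a * t + (1 - a) * 1) (𝓝[>] 0) (𝓝 1) := by
    have : Continuous fun a : ℝ => a * t + (1 - a) * 1 := by fun_prop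
    simpa using (this.tendsto 0).mono_left nhdsWithin_le_nhds
  have hev := (hcont.tendsto.comp hlim).eventually_const_lt h2
  have h1 : ∀ᶠ a : ℝ in 𝓝[>] 0, a < 1 :=
    nhdsWithin_le_nhds (eventually_lt_nhds one_pos)
  obtain ⟨a, ha, ha1, ha0⟩ := (hev.and (h1.and self_mem_nhdsWithin)).exists
  have ha0 : (0 : ℝ) < a := ha0
  -- `φ` vanishes near the interior point `a t + (1 - a)` of the interval.
  have hloc : (fun t => (φ t).toReal) =ᶠ[𝓝 (a * t + (1 - a) * 1)] fun _ => (0 : ℝ) := by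
    have ht1 : t - 1 ≠ 0 := sub_ne_zero.2 ht
    have hinv : Tendsto (fun x : ℝ => (x - 1) / (t - 1)) (𝓝 (a * t + (1 - a) * 1)) (𝓝 a) := by
      have hc : Continuous fun x : ℝ => (x - 1) / (t - 1) := by fun_prop
      have := hc.tendsto (a * t + (1 - a) * 1)
      rwa [show (a * t + (1 - a) * 1 - 1) / (t - 1) = a by field_simp; ring] at this
    filter_upwards [hinv.eventually_const_lt ha0, hinv.eventually_lt_const ha1] with x hx0 hx1
    have := hz _ hx0.le hx1.le
    rwa [show (x - 1) / (t - 1) * t + (1 - (x - 1) / (t - 1)) * 1 = x by field_simp; ring] at this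
  have := hloc.iteratedDeriv_eq 2
  simp only [Function.comp_apply] at ha
  rw [this] at ha
  simp at ha

/-- Linear growth of `φ` beyond a point `1 + σ` at which it is positive. -/
theorem exists_growth_of_ne_zero (hφ : IsDivergenceFunction φ) {σ : ℝ} (hσ : σ ≠ 0)
    (hpos : φ (1 + σ) ≠ 0) :
    ∃ κ > 0, ∀ r, 1 ≤ r → φ (1 + r * σ) < ⊤ → κ * |r * σ| ≤ (φ (1 + r * σ)).toReal := by
  have hm : 0 < (min (φ (1 + σ)) 1).toReal :=
    ENNReal.toReal_pos (by simp [min_eq_iff, hpos]) (by simp)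
  refine ⟨(min (φ (1 + σ)) 1).toReal / |σ|, div_pos hm (abs_pos.2 hσ), fun r hr ht => ?_⟩
  have hr0 : 0 < r := by linarith
  have h1 : φ 1 < ⊤ := by simp [hφ.one]
  have ha : 0 ≤ 1 - r⁻¹ := sub_nonneg.2 (inv_le_one_of_one_le₀ hr)
  have hpt : r⁻¹ * (1 + r * σ) + (1 - r⁻¹) * 1 = 1 + σ := by field_simp; ring
  have hle := hφ.convex_toReal_le (inv_nonneg.2 hr0.le) ha (by ring) ht h1
  have hlt := hφ.convex_lt_top (inv_nonneg.2 hr0.le) ha (by ring) ht h1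
  rw [hpt] at hle hlt
  have hmin : (min (φ (1 + σ)) 1).toReal ≤ (φ (1 + σ)).toReal :=
    ENNReal.toReal_mono hlt.ne (min_le_left _ _)
  rw [hφ.one, ENNReal.toReal_zero, mul_zero, add_zero, inv_mul_eq_div, le_div_iff₀ hr0] at hle
  rw [abs_mul, abs_of_pos hr0, div_mul_eq_mul_div, mul_div_assoc,
    mul_div_cancel_right₀ _ (abs_pos.2 hσ).ne']
  nlinarith

theorem exists_growth (hφ : IsDivergenceFunction φ) (hpos : ∀ t ≠ 1, φ t ≠ 0) {ε : ℝ}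
    (hε : 0 < ε) : ∃ κ > 0, ∀ t, φ t < ⊤ → ε ≤ |t - 1| → κ * |t - 1| ≤ (φ t).toReal := by
  obtain ⟨κ₁, hκ₁, h₁⟩ := exists_growth_of_ne_zero hφ hε.ne' (hpos (1 + ε) (by simpa using hε.ne'))
  obtain ⟨κ₂, hκ₂, h₂⟩ := exists_growth_of_ne_zero hφ (neg_ne_zero.2 hε.ne')
    (hpos (1 + -ε) (by simpa using hε.ne'))
  refine ⟨min κ₁ κ₂, lt_min hκ₁ hκ₂, fun t ht hεt => ?_⟩
  rcases le_total 0 (t - 1) with h0 | h0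
  · rw [abs_of_nonneg h0] at hεt
    have heq : 1 + (t - 1) / ε * ε = t := by field_simp; ring
    have := h₁ ((t - 1) / ε) ((one_le_div hε).2 hεt) (by rwa [heq])
    rw [heq, div_mul_cancel₀ _ hε.ne'] at this
    exact (mul_le_mul_of_nonneg_right (min_le_left _ _) (abs_nonneg _)).trans this
  · rw [abs_of_nonpos h0] at hεt
    have heq : 1 + -(t - 1) / ε * -ε = t := by field_simp; ring
    have := h₂ (-(t - 1) / ε) ((one_le_div hε).2 hεt) (by rwa [heq])
    rw [heq, show -(t - 1) / ε * -ε = t - 1 by field_simp] at this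
    exact (mul_le_mul_of_nonneg_right (min_le_right _ _) (abs_nonneg _)).trans this

/-- With penalty `1 / c → ∞` the best density tends to `1`, whose linear payoff vanishes by symmetry.
Quantitatively, `s t - φ(t) ≤ s + ε |s|` for all `t` once `|s|` is below the growth rate of `φ`. -/
theorem tendsto_tiltValue_zero (hφ : IsDivergenceFunction φ) (hpos : ∀ t ≠ 1, φ t ≠ 0)
    (g : E →L[ℝ] ℝ) :
    Tendsto (fun c : ℝ => tiltValue φ (c • g) / c) (𝓝[>] 0) (𝓝 0) := by
  rw [Metric.tendsto_nhds]
  intro ε hε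
  let r := ε / (2 * (‖g‖ + 1))
  have hr : 0 < r := by positivity
  have hrg : r * ‖g‖ < ε := by
    rw [div_mul_eq_mul_div, div_lt_iff₀ (by positivity)]
    nlinarith [norm_nonneg g]
  obtain ⟨κ, hκ, hgrow⟩ := exists_growth hφ hpos hr
  have hcκ : ∀ᶠ c : ℝ in 𝓝[>] 0, c * ‖g‖ < κ := by
    refine nhdsWithin_le_nhds (Tendsto.eventually_lt_const hκ ?_)
    have hc : Continuous fun c : ℝ => c * ‖g‖ := by fun_prop
    simpa using hc.tendsto 0
  filter_upwards [self_mem_nhdsWithin, hcκ] with c (hc : 0 < c) hcg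
  have hle : tiltValue φ (c • g) ≤ c * (r * ‖g‖) := by
    refine tiltValue_le hφ fun h hh => ?_
    have : payoff φ (c • g) h ≤ ∫ b, ((c • g) b + c * (r * ‖g‖)) ∂(unitUnif E) := by
      refine integral_mono_ae (integrable_payoff φ _ h)
        ((integrable_apply_unitUnif _).add (integrable_const _)) ?_
      filter_upwards [ae_norm_apply_le (c • g)] with b hb
      rw [norm_smul, Real.norm_of_nonneg hc.le, Real.norm_eq_abs] at hb
      set s := (c • g) b
      have h1 : s * (h b - 1) ≤ c * ‖g‖ * |h b - 1| :=
        (le_abs_self _).trans (by rw [abs_mul]; gcongr)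
      have h2 : 0 ≤ (φ (h b)).toReal := ENNReal.toReal_nonneg
      rcases le_total r |h b - 1| with hcase | hcase
      · have h3 := hgrow _ (hh.lt_top b) hcase
        have h4 : 0 ≤ c * (r * ‖g‖) := by positivity
        nlinarith [abs_nonneg (h b - 1)]
      · have h3 : c * ‖g‖ * |h b - 1| ≤ c * ‖g‖ * r := by gcongr
        linarith
    refine this.trans (le_of_eq ?_)
    rw [integral_add (integrable_apply_unitUnif _) (integrable_const _), integral_apply_unitUnif]
    simp
  rw [Real.dist_eq, sub_zero, abs_of_nonneg (div_nonneg (tiltValue_nonneg hφ _) hc.le),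
    div_lt_iff₀ hc]
  nlinarith

end Tilt

/-! ### First-order expansion of the loss -/

section Smooth

variable {E : Type*} [NormedAddCommGroup E] [NormedSpace ℝ E] {f : E → ℝ} {S : E → ℝ}

theorem continuous_fderiv_of_norm_sub_le
    (hS : ∀ x x' : E, ‖fderiv ℝ f x - fderiv ℝ f x'‖ ≤ S x * ‖x - x'‖) :
    Continuous (fderiv ℝ f) := by
  refine continuous_iff_continuousAt.2 fun x => ?_
  rw [ContinuousAt, tendsto_iff_norm_sub_tendsto_zero]
  have hlim : Tendsto (fun y => S x * ‖x - y‖) (𝓝 x) (𝓝 0) := by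
    have hc : Continuous fun y => S x * ‖x - y‖ := by fun_prop
    simpa using hc.tendsto x
  refine squeeze_zero (fun _ => norm_nonneg _) (fun y => ?_) hlim
  rw [norm_sub_rev]
  exact hS x y

theorem abs_sub_sub_fderiv_le (hf : Differentiable ℝ f)
    (hS : ∀ x x' : E, ‖fderiv ℝ f x - fderiv ℝ f x'‖ ≤ S x * ‖x - x'‖) (x y : E) :
    |f y - f x - fderiv ℝ f x (y - x)| ≤ |S x| * ‖y - x‖ ^ 2 := by
  have := Convex.norm_image_sub_le_of_norm_hasFDerivWithin_le' (f := f) (f' := fderiv ℝ f)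
    (φ := fderiv ℝ f x) (C := |S x| * ‖y - x‖) (s := Metric.closedBall x ‖y - x‖) (x := x) (y := y)
    (fun z _ => (hf z).hasFDerivAt.hasFDerivWithinAt) (fun z hz => ?_) (convex_closedBall _ _)
    (by simp) (by simp [dist_eq_norm])
  · rw [Real.norm_eq_abs] at this
    linarith
  · rw [norm_sub_rev]
    have hz' : ‖x - z‖ ≤ ‖y - x‖ := by rwa [← dist_eq_norm, dist_comm]
    exact (hS x z).trans (mul_le_mul (le_abs_self _) hz' (norm_nonneg _) (abs_nonneg _))

variable [FiniteDimensional ℝ E] [MeasurableSpace E] [BorelSpace E]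

/-- Along a coupling that moves points by at most `ρ`, the expected loss is that of its linear
expansion up to `ρ² E|S|`. -/
theorem abs_integral_snd_sub_le {P : Measure E} (hf : Differentiable ℝ f)
    (hS : ∀ x x' : E, ‖fderiv ℝ f x - fderiv ℝ f x'‖ ≤ S x * ‖x - x'‖)
    (hf_int : Integrable f P) (hgrad_int : Integrable (fun z => ‖fderiv ℝ f z‖) P)
    (hS_int : Integrable S P) {γ : Measure (E × E)} (hfst : γ.map Prod.fst = P) {ρ : ℝ}
    (hclose : ∀ᵐ p ∂γ, ‖p.1 - p.2‖ ≤ ρ) :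
    Integrable (fun p => fderiv ℝ f p.1 (p.2 - p.1)) γ ∧
      |(∫ z, f z ∂(γ.map Prod.snd)) - ∫ z, f z ∂P - ∫ p, fderiv ℝ f p.1 (p.2 - p.1) ∂γ| ≤
        ρ ^ 2 * ∫ z, |S z| ∂P := by
  have hG := continuous_fderiv_of_norm_sub_le hS
  have hfc := hf.continuous
  have hlin : Continuous fun p : E × E => fderiv ℝ f p.1 (p.2 - p.1) := by fun_prop
  subst hfst
  have h1 : Integrable (fun p : E × E => f p.1) γ := hf_int.comp_measurable measurable_fst
  have h2 : Integrable (fun p : E × E => ‖fderiv ℝ f p.1‖) γ :=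
    hgrad_int.comp_measurable measurable_fst
  have h3 : Integrable (fun p : E × E => |S p.1|) γ := hS_int.abs.comp_measurable measurable_fst
  have hL : Integrable (fun p => fderiv ℝ f p.1 (p.2 - p.1)) γ := by
    refine (h2.mul_const ρ).mono' hlin.aestronglyMeasurable ?_
    filter_upwards [hclose] with p hp
    rw [norm_sub_rev] at hp
    exact ((fderiv ℝ f p.1).le_opNorm _).trans (by gcongr)
  have hT : ∀ᵐ p ∂γ, |f p.2 - f p.1 - fderiv ℝ f p.1 (p.2 - p.1)| ≤ ρ ^ 2 * |S p.1| := by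
    filter_upwards [hclose] with p hp
    rw [norm_sub_rev] at hp
    refine (abs_sub_sub_fderiv_le hf hS p.1 p.2).trans ?_
    rw [mul_comm]
    gcongr
  have hR : Integrable (fun p => f p.2 - f p.1 - fderiv ℝ f p.1 (p.2 - p.1)) γ :=
    (h3.const_mul (ρ ^ 2)).mono' (by fun_prop) hT
  have h4 : Integrable (fun p : E × E => f p.2) γ := by
    refine ((hR.add hL).add h1).congr (Eventually.of_forall fun p => ?_)
    simp
  have h5 : Integrable (fun p : E × E => f p.2 - f p.1) γ := h4.sub h1
  refine ⟨hL, ?_⟩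
  rw [integral_map measurable_snd.aemeasurable hfc.aestronglyMeasurable,
    integral_map measurable_fst.aemeasurable hfc.aestronglyMeasurable,
    integral_map measurable_fst.aemeasurable hS_int.abs.aestronglyMeasurable,
    ← integral_sub h4 h1, ← integral_sub h5 hL, ← integral_const_mul]
  rw [← Real.norm_eq_abs]
  simp only [← Real.norm_eq_abs (_ - _)] at hT
  exact norm_integral_le_of_norm_le (h3.const_mul (ρ ^ 2)) hT

end Smooth

/-! ### Couplings with a density -/

section Coupling

variable {E : Type*} [NormedAddCommGroup E] [NormedSpace ℝ E] [FiniteDimensional ℝ E]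
  [MeasurableSpace E] [BorelSpace E] {P : Measure E} [IsProbabilityMeasure P] {ρ : ℝ}

theorem lintegral_refMeasure (hρ : 0 < ρ) {F : E × E → ℝ≥0∞} (hF : Measurable F) :
    ∫⁻ p, F p ∂(refMeasure P ρ) = ∫⁻ z, ∫⁻ b, F (z, z + ρ • b) ∂(unitUnif E) ∂P := by
  have hm : Measurable fun p : E × E => (p.1, p.1 + ρ • p.2) := by fun_prop
  rw [refMeasure_eq_map P hρ, lintegral_map hF hm]
  exact lintegral_prod _ (hF.comp hm).aemeasurable

theorem map_fst_withDensity (hρ : 0 < ρ) {K : E × E → ℝ≥0∞} (hK : Measurable K) :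
    ((refMeasure P ρ).withDensity K).map Prod.fst =
      P.withDensity fun z => ∫⁻ b, K (z, z + ρ • b) ∂(unitUnif E) := by
  ext A hA
  rw [Measure.map_apply measurable_fst hA, withDensity_apply _ (measurable_fst hA),
    withDensity_apply _ hA, ← lintegral_indicator (measurable_fst hA), ← lintegral_indicator hA,
    lintegral_refMeasure hρ (hK.indicator (measurable_fst hA))]
  refine lintegral_congr fun z => ?_
  by_cases hz : z ∈ A <;> simp [hz, Set.indicator]

theorem ae_norm_sub_le_refMeasure (hρ : 0 < ρ) : ∀ᵐ p ∂(refMeasure P ρ), ‖p.1 - p.2‖ ≤ ρ := by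
  have hm : Measurable fun p : E × E => (p.1, p.1 + ρ • p.2) := by fun_prop
  rw [refMeasure_eq_map P hρ, ae_map_iff hm.aemeasurable
    (measurableSet_le (by fun_prop) measurable_const)]
  filter_upwards [Measure.quasiMeasurePreserving_snd.ae (ae_norm_le_one_unitUnif (E := E))]
    with p hp
  simpa [norm_smul, abs_of_pos hρ] using mul_le_of_le_one_right hρ.le hp

theorem ae_lintegral_density_eq_one (hρ : 0 < ρ) {K : E × E → ℝ≥0∞} (hK : Measurable K)
    (hfst : ((refMeasure P ρ).withDensity K).map Prod.fst = P) :
    ∀ᵐ z ∂P, ∫⁻ b, K (z, z + ρ • b) ∂(unitUnif E) = 1 := by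
  rw [map_fst_withDensity hρ hK] at hfst
  have hm : Measurable fun z => ∫⁻ b, K (z, z + ρ • b) ∂(unitUnif E) :=
    Measurable.lintegral_prod_right' (f := fun p : E × E => K (p.1, p.1 + ρ • p.2))
      (hK.comp (by fun_prop))
  have h1 : P.withDensity (fun z => ∫⁻ b, K (z, z + ρ • b) ∂(unitUnif E)) =
      P.withDensity fun _ => 1 := by
    rw [hfst]
    exact withDensity_one.symm
  exact (withDensity_eq_iff_of_sigmaFinite hm.aemeasurable measurable_const.aemeasurable).1 h1

theorem phiDiv_withDensity (φ : ℝ → ℝ≥0∞) (hρ : 0 < ρ) {K : E × E → ℝ≥0∞} (hK : Measurable K) :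
    phiDiv φ ((refMeasure P ρ).withDensity K) (refMeasure P ρ) =
      ∫⁻ p, φ (K p).toReal ∂(refMeasure P ρ) := by
  have := isProbabilityMeasure_refMeasure P hρ
  rw [phiDiv, if_pos (withDensity_absolutelyContinuous _ _)]
  refine lintegral_congr_ae ?_
  filter_upwards [Measure.rnDeriv_withDensity (refMeasure P ρ) hK] with p hp
  rw [hp]

/-- Disintegration over the first coordinate of the linearized objective at a coupling with
density `K` of finite divergence. -/
theorem integral_linear_sub_phiDiv {φ : ℝ → ℝ≥0∞} (hφ : IsDivergenceFunction φ) (hρ : 0 < ρ)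
    (η : ℝ) {G : E → E →L[ℝ] ℝ} {K : E × E → ℝ≥0∞} (hK : Measurable K)
    (hK_top : ∀ᵐ p ∂(refMeasure P ρ), K p < ⊤)
    (hL : Integrable (fun p => G p.1 (p.2 - p.1)) ((refMeasure P ρ).withDensity K))
    (hdiv : ∫⁻ p, φ (K p).toReal ∂(refMeasure P ρ) ≠ ⊤) :
    Integrable (fun z => ρ * ∫ b, G z b * (K (z, z + ρ • b)).toReal ∂(unitUnif E) -
        η * ∫ b, (φ (K (z, z + ρ • b)).toReal).toReal ∂(unitUnif E)) P ∧
      (∫ p, G p.1 (p.2 - p.1) ∂((refMeasure P ρ).withDensity K)) -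
        η * (∫⁻ p, φ (K p).toReal ∂(refMeasure P ρ)).toReal =
      ∫ z, (ρ * ∫ b, G z b * (K (z, z + ρ • b)).toReal ∂(unitUnif E) -
        η * ∫ b, (φ (K (z, z + ρ • b)).toReal).toReal ∂(unitUnif E)) ∂P := by
  have hm : Measurable fun p : E × E => (p.1, p.1 + ρ • p.2) := by fun_prop
  have hφK : Measurable fun p : E × E => φ (K p).toReal := hφ.measurable.comp hK.ennreal_toReal
  rw [integrable_withDensity_iff_integrable_smul' hK hK_top] at hL
  have hD : Integrable (fun p => (φ (K p).toReal).toReal) (refMeasure P ρ) :=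
    integrable_toReal_of_lintegral_ne_top hφK.aemeasurable hdiv
  rw [integral_withDensity_eq_integral_toReal_smul hK hK_top,
    ← integral_toReal hφK.aemeasurable (ae_lt_top hφK hdiv)]
  rw [refMeasure_eq_map P hρ] at hL hD ⊢
  have hLm := hL.aestronglyMeasurable
  have hDm := hD.aestronglyMeasurable
  rw [integral_map hm.aemeasurable hLm, integral_map hm.aemeasurable hDm]
  replace hL := hL.comp_measurable hm
  replace hD := hD.comp_measurable hm
  have hinner : ∀ z, ∫ b, (K (z, z + ρ • b)).toReal • G z (z + ρ • b - z) ∂(unitUnif E) =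
      ρ * ∫ b, G z b * (K (z, z + ρ • b)).toReal ∂(unitUnif E) := fun z => by
    rw [← integral_const_mul]
    refine integral_congr_ae (Eventually.of_forall fun b => ?_)
    simp only [add_sub_cancel_left, map_smul, smul_eq_mul]
    ring
  have hL1 := hL.integral_prod_left
  have hD1 := hD.integral_prod_left
  have hL2 := integral_prod _ hL
  have hD2 := integral_prod _ hD
  simp only [Function.comp_apply, hinner] at hL1 hD1 hL2 hD2
  exact ⟨hL1.sub (hD1.const_mul η), by
    rw [hL2, hD2, integral_sub hL1 (hD1.const_mul η), integral_const_mul η]⟩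

end Coupling

/-! ### The robust value up to second order in the radius -/

section Value

variable {E : Type*} [NormedAddCommGroup E] [NormedSpace ℝ E] [FiniteDimensional ℝ E]
  [MeasurableSpace E] [BorelSpace E] {φ : ℝ → ℝ≥0∞}

theorem integrable_tiltValue {P : Measure E} (hφ : IsDivergenceFunction φ)
    {G : E → E →L[ℝ] ℝ} (hG : Continuous G) (hG_int : Integrable (fun z => ‖G z‖) P) (c : ℝ) :
    Integrable (fun z => tiltValue φ (c • G z)) P := by
  refine (hG_int.const_mul |c|).mono'
    ((continuous_tiltValue hφ).comp (hG.const_smul c)).aestronglyMeasurable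
    (Eventually.of_forall fun z => ?_)
  rw [Real.norm_of_nonneg (tiltValue_nonneg hφ _), ← Real.norm_eq_abs, ← norm_smul]
  exact tiltValue_le_norm hφ _

/-- Rescaling of the payoff from radius `ρ` and penalty `η` to the slope `ρ / η`. -/
theorem mul_integral_sub_eq {ρ η : ℝ} (hη : 0 < η) (g : E →L[ℝ] ℝ) (k : E → ℝ) (D : ℝ) :
    ρ * ∫ b, g b * k b ∂(unitUnif E) - η * D =
      η * ((∫ b, ((ρ / η) • g) b * k b ∂(unitUnif E)) - D) := by
  simp only [FunLike.coe_smul, Pi.smul_apply, smul_eq_mul, mul_assoc]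
  rw [integral_const_mul, mul_sub, ← mul_assoc, mul_div_cancel₀ _ hη.ne']

/-- Near-optimal simple densities can be selected measurably: as the tilted value is Lipschitz,
one density serves all functionals in a small ball, and countably many balls suffice. -/
theorem exists_measurable_selection (hφ : IsDivergenceFunction φ) {G : E → E →L[ℝ] ℝ}
    (hG : Measurable G) {ε : ℝ} (hε : 0 < ε) :
    ∃ (N : E → ℕ) (h : ℕ → SimpleFunc E ℝ), Measurable N ∧ (∀ n, IsDensity φ (h n)) ∧
      ∀ z, tiltValue φ (G z) - 3 * ε ≤ payoff φ (G z) (h (N z)) := by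
  classical
  let d := TopologicalSpace.denseSeq (E →L[ℝ] ℝ)
  have hd : DenseRange d := TopologicalSpace.denseRange_denseSeq _
  have hex : ∀ z, ∃ n, ‖G z - d n‖ < ε := fun z => by
    obtain ⟨n, hn⟩ := hd.exists_dist_lt (G z) hε
    exact ⟨n, by rwa [← dist_eq_norm]⟩
  choose h hh hpay using fun n => exists_lt_payoff (E := E) hφ (g := d n)
    (a := tiltValue φ (d n) - ε) (by linarith)
  refine ⟨fun z => Nat.find (hex z), h, measurable_find hex fun n => ?_, hh, fun z => ?_⟩
  · exact measurableSet_lt (hG.sub_const _).norm measurable_const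
  · have h1 := Nat.find_spec (hex z)
    set n := Nat.find (hex z)
    have h2 := tiltValue_le_add hφ (G z) (d n)
    have h3 := (hh n).payoff_le_add hφ (d n) (G z)
    rw [norm_sub_rev] at h3
    linarith [hpay n]

variable {P : Measure E} [IsProbabilityMeasure P] {f S : E → ℝ}

theorem robustValue_le (hφ : IsDivergenceFunction φ) (hf : Differentiable ℝ f)
    (hS : ∀ x x' : E, ‖fderiv ℝ f x - fderiv ℝ f x'‖ ≤ S x * ‖x - x'‖)
    (hf_int : Integrable f P) (hgrad_int : Integrable (fun z => ‖fderiv ℝ f z‖) P)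
    (hS_int : Integrable S P) {ρ η : ℝ} (hρ : 0 < ρ) (hη : 0 < η) :
    robustValue φ P f ρ η ≤ (((∫ z, f z ∂P) +
      η * ∫ z, tiltValue φ ((ρ / η) • fderiv ℝ f z) ∂P + ρ ^ 2 * ∫ z, |S z| ∂P : ℝ) : EReal) := by
  refine sSup_le ?_
  rintro _ ⟨Q, γ, hγ, hfst, rfl, hclose, rfl⟩
  by_cases hdiv : phiDiv φ γ (refMeasure P ρ) = ⊤
  · simp [hdiv, EReal.coe_mul_top_of_pos hη]
  have hprob := isProbabilityMeasure_refMeasure P hρ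
  have hac : γ ≪ refMeasure P ρ := by
    by_contra hc
    exact hdiv (by rw [phiDiv, if_neg hc])
  obtain ⟨hL, hexp⟩ := abs_integral_snd_sub_le hf hS hf_int hgrad_int hS_int hfst hclose
  have hK : Measurable (γ.rnDeriv (refMeasure P ρ)) := Measure.measurable_rnDeriv _ _
  have hsf : SFinite γ := inferInstance
  have hdec : γ.HaveLebesgueDecomposition (refMeasure P ρ) := inferInstance
  have hγK := Measure.withDensity_rnDeriv_eq γ (refMeasure P ρ) hac
  set K := γ.rnDeriv (refMeasure P ρ)
  have hK_top : ∀ᵐ p ∂(refMeasure P ρ), K p < ⊤ := Measure.rnDeriv_lt_top _ _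
  have hphi : phiDiv φ γ (refMeasure P ρ) = ∫⁻ p, φ (K p).toReal ∂(refMeasure P ρ) := by
    rw [← hγK]
    exact phiDiv_withDensity φ hρ hK
  rw [hphi] at hdiv
  have hone := ae_lintegral_density_eq_one (P := P) hρ hK (by rw [hγK, hfst])
  have hdiv_ae : ∀ᵐ z ∂P, ∫⁻ b, φ (K (z, z + ρ • b)).toReal ∂(unitUnif E) < ⊤ := by
    have hφK : Measurable fun p : E × E => φ (K p).toReal := hφ.measurable.comp hK.ennreal_toReal
    rw [lintegral_refMeasure hρ hφK] at hdiv
    refine ae_lt_top ?_ hdiv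
    exact Measurable.lintegral_prod_right'
      (f := fun p : E × E => φ (K (p.1, p.1 + ρ • p.2)).toReal) (hφK.comp (by fun_prop))
  obtain ⟨hint, heq⟩ := integral_linear_sub_phiDiv (P := P) hφ hρ η (G := fderiv ℝ f) hK hK_top
    (by rwa [hγK]) hdiv
  rw [hγK] at heq
  have hle : ∫ z, (ρ * ∫ b, fderiv ℝ f z b * (K (z, z + ρ • b)).toReal ∂(unitUnif E) -
        η * ∫ b, (φ (K (z, z + ρ • b)).toReal).toReal ∂(unitUnif E)) ∂P ≤
      ∫ z, η * tiltValue φ ((ρ / η) • fderiv ℝ f z) ∂P := by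
    refine integral_mono_ae hint ((integrable_tiltValue hφ
      (continuous_fderiv_of_norm_sub_le hS) hgrad_int _).const_mul η) ?_
    filter_upwards [hone, hdiv_ae] with z hz1 hz2
    rw [mul_integral_sub_eq hη]
    refine mul_le_mul_of_nonneg_left ?_ hη.le
    have hKz : Measurable fun b => K (z, z + ρ • b) := hK.comp (by fun_prop)
    refine payoff_le_tiltValue_of_density hφ _
      (integrable_toReal_of_lintegral_ne_top hKz.aemeasurable (by simp [hz1])) ?_ hz2.ne
    rw [integral_toReal hKz.aemeasurable (ae_lt_top hKz (by simp [hz1])), hz1,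
      ENNReal.toReal_one]
  rw [integral_const_mul] at hle
  rw [hphi, ← EReal.coe_ennreal_toReal hdiv, ← EReal.coe_mul, ← EReal.coe_sub,
    EReal.coe_le_coe_iff]
  linarith [(abs_le.1 hexp).2]

theorem le_robustValue (hφ : IsDivergenceFunction φ) (hf : Differentiable ℝ f)
    (hS : ∀ x x' : E, ‖fderiv ℝ f x - fderiv ℝ f x'‖ ≤ S x * ‖x - x'‖)
    (hf_int : Integrable f P) (hgrad_int : Integrable (fun z => ‖fderiv ℝ f z‖) P)
    (hS_int : Integrable S P) {ρ η : ℝ} (hρ : 0 < ρ) (hη : 0 < η) {ε : ℝ} (hε : 0 < ε) :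
    (((∫ z, f z ∂P) + η * ((∫ z, tiltValue φ ((ρ / η) • fderiv ℝ f z) ∂P) - 3 * ε) -
      ρ ^ 2 * ∫ z, |S z| ∂P : ℝ) : EReal) ≤ robustValue φ P f ρ η := by
  have hG := continuous_fderiv_of_norm_sub_le hS
  have hprob := isProbabilityMeasure_refMeasure P hρ
  obtain ⟨N, h, hN, hh, hpay⟩ := exists_measurable_selection hφ
    (G := fun z => (ρ / η) • fderiv ℝ f z) (hG.const_smul (ρ / η)).measurable hε
  have hnn : ∀ n b, 0 ≤ h n b := fun n b => hφ.nonneg_of_lt_top ((hh n).lt_top b)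
  let K : E × E → ℝ≥0∞ := fun p => ENNReal.ofReal (h (N p.1) (ρ⁻¹ • (p.2 - p.1)))
  have hKz : ∀ z b, K (z, z + ρ • b) = ENNReal.ofReal (h (N z) b) := fun z b => by
    simp [K, smul_smul, inv_mul_cancel₀ hρ.ne']
  have hKr : ∀ z b, (K (z, z + ρ • b)).toReal = h (N z) b := fun z b => by
    rw [hKz, ENNReal.toReal_ofReal (hnn _ _)]
  have hK : Measurable K := by
    have h1 : Measurable fun q : ℕ × E => h q.1 q.2 :=
      measurable_from_prod_countable_right fun n => (h n).measurable
    have h2 : Measurable fun p : E × E => (N p.1, ρ⁻¹ • (p.2 - p.1)) :=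
      (hN.comp measurable_fst).prodMk (by fun_prop)
    exact (h1.comp h2).ennreal_ofReal
  have hK_top : ∀ᵐ p ∂(refMeasure P ρ), K p < ⊤ :=
    Eventually.of_forall fun p => ENNReal.ofReal_lt_top
  have hφK : Measurable fun p : E × E => φ (K p).toReal := hφ.measurable.comp hK.ennreal_toReal
  set γ := (refMeasure P ρ).withDensity K with hγdef
  have hfst : γ.map Prod.fst = P := by
    rw [hγdef, map_fst_withDensity hρ hK]
    simp only [hKz]
    have : ∀ z, ∫⁻ b, ENNReal.ofReal (h (N z) b) ∂(unitUnif E) = 1 := fun z => by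
      rw [← ofReal_integral_eq_lintegral_ofReal (h (N z)).integrable_of_isFiniteMeasure
        (Eventually.of_forall (hnn _)), (hh _).integral_eq_one, ENNReal.ofReal_one]
    simp only [this]
    exact withDensity_one
  have hγ : IsProbabilityMeasure γ := by
    refine ⟨?_⟩
    rw [← Set.preimage_univ (f := Prod.fst), ← Measure.map_apply measurable_fst MeasurableSet.univ,
      hfst, measure_univ]
  have hclose : ∀ᵐ p ∂γ, ‖p.1 - p.2‖ ≤ ρ :=
    (withDensity_absolutelyContinuous _ _).ae_le (ae_norm_sub_le_refMeasure hρ)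
  obtain ⟨hL, hexp⟩ := abs_integral_snd_sub_le hf hS hf_int hgrad_int hS_int hfst hclose
  -- A near-optimal density has divergence at most the norm of the functional, up to `ε`.
  have hdiv : ∫⁻ p, φ (K p).toReal ∂(refMeasure P ρ) ≠ ⊤ := by
    rw [lintegral_refMeasure hρ hφK]
    have hbound : Integrable (fun z => ‖(ρ / η) • fderiv ℝ f z‖ + 3 * ε) P := by
      simp only [norm_smul]
      exact (hgrad_int.const_mul _).add (integrable_const _)
    refine ((lintegral_mono fun z => ?_).trans_lt hbound.lintegral_lt_top).ne
    simp only [hKr]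
    have h1 : ∀ b, φ (h (N z) b) = ENNReal.ofReal (φ (h (N z) b)).toReal := fun b =>
      (ENNReal.ofReal_toReal ((hh _).lt_top b).ne).symm
    rw [lintegral_congr h1, ← ofReal_integral_eq_lintegral_ofReal
      (integrable_toReal_comp_simpleFunc φ _)
      (Eventually.of_forall fun _ => ENNReal.toReal_nonneg)]
    refine ENNReal.ofReal_le_ofReal ?_
    have h2 := (hh (N z)).payoff_le_norm_sub hφ ((ρ / η) • fderiv ℝ f z)
    linarith [hpay z, tiltValue_nonneg hφ ((ρ / η) • fderiv ℝ f z)]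
  obtain ⟨hint, heq⟩ := integral_linear_sub_phiDiv (P := P) hφ hρ η (G := fderiv ℝ f) hK hK_top
    hL hdiv
  have hT := integrable_tiltValue hφ hG hgrad_int (ρ / η)
  have hle : ∫ z, η * (tiltValue φ ((ρ / η) • fderiv ℝ f z) - 3 * ε) ∂P ≤
      ∫ z, (ρ * ∫ b, fderiv ℝ f z b * (K (z, z + ρ • b)).toReal ∂(unitUnif E) -
        η * ∫ b, (φ (K (z, z + ρ • b)).toReal).toReal ∂(unitUnif E)) ∂P := by
    refine integral_mono ((hT.sub (integrable_const _)).const_mul η) hint fun z => ?_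
    simp only [hKr]
    rw [mul_integral_sub_eq hη, ← payoff_eq]
    exact mul_le_mul_of_nonneg_left (hpay z) hη.le
  rw [integral_const_mul, integral_sub hT (integrable_const _), integral_const,
    probReal_univ, one_smul] at hle
  refine le_trans ?_ (le_sSup ⟨_, γ, hγ, hfst, rfl, hclose, rfl⟩)
  rw [phiDiv_withDensity φ hρ hK, ← EReal.coe_ennreal_toReal hdiv, ← EReal.coe_mul,
    ← EReal.coe_sub, EReal.coe_le_coe_iff]
  linarith [(abs_le.1 hexp).1]

/-- The gap is, up to `ρ² E|S|`, the mean over `P` of the tilted value of the gradient. -/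
theorem exists_gap_eq (hφ : IsDivergenceFunction φ) (hf : Differentiable ℝ f)
    (hS : ∀ x x' : E, ‖fderiv ℝ f x - fderiv ℝ f x'‖ ≤ S x * ‖x - x'‖)
    (hf_int : Integrable f P) (hgrad_int : Integrable (fun z => ‖fderiv ℝ f z‖) P)
    (hS_int : Integrable S P) {ρ η : ℝ} (hρ : 0 < ρ) (hη : 0 < η) :
    ∃ r : ℝ, gap φ P f ρ η = r ∧
      |r - η * ∫ z, tiltValue φ ((ρ / η) • fderiv ℝ f z) ∂P| ≤ ρ ^ 2 * ∫ z, |S z| ∂P := by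
  have hup := robustValue_le hφ hf hS hf_int hgrad_int hS_int hρ hη
  have hlow := fun ε (hε : 0 < ε) =>
    le_robustValue hφ hf hS hf_int hgrad_int hS_int hρ hη hε
  rw [gap]
  generalize robustValue φ P f ρ η = V at hup hlow
  induction V with
  | top => exact absurd hup (not_le.2 (EReal.coe_lt_top _))
  | bot => exact absurd (hlow 1 one_pos) (not_le.2 (EReal.bot_lt_coe _))
  | coe v =>
    refine ⟨v - ∫ z, f z ∂P, (EReal.coe_sub _ _).symm, ?_⟩
    rw [EReal.coe_le_coe_iff] at hup
    refine abs_le.2 ⟨?_, by linarith⟩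
    refine le_of_forall_pos_le_add fun δ hδ => ?_
    have := EReal.coe_le_coe_iff.1 (hlow (δ / (3 * η)) (by positivity))
    rw [mul_sub, show η * (3 * (δ / (3 * η))) = δ by field_simp] at this
    linarith

/-! ### The three regimes -/

/-- Reduction of the three regimes to the mean tilted value at slope `ρ / η`. -/
theorem gapIsLittleO_of_tendsto (hφ : IsDivergenceFunction φ) (hf : Differentiable ℝ f)
    (hS : ∀ x x' : E, ‖fderiv ℝ f x - fderiv ℝ f x'‖ ≤ S x * ‖x - x'‖)
    (hf_int : Integrable f P) (hgrad_int : Integrable (fun z => ‖fderiv ℝ f z‖) P)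
    (hS_int : Integrable S P) {ι : Type*} {l : Filter ι} {ρ η : ι → ℝ}
    (hρ_pos : ∀ᶠ i in l, 0 < ρ i) (hη_pos : ∀ᶠ i in l, 0 < η i) (hρ : Tendsto ρ l (𝓝 0))
    {B : ι → EReal} {R : ι → ℝ} (hB : ∀ᶠ i in l, B i = ((ρ i * R i : ℝ) : EReal))
    (hR : Tendsto (fun i =>
      (∫ z, tiltValue φ ((ρ i / η i) • fderiv ℝ f z) ∂P) / (ρ i / η i) - R i) l (𝓝 0)) :
    GapIsLittleO l (fun i => gap φ P f (ρ i) (η i)) B ρ := by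
  intro ε hε
  have h1 : ∀ᶠ i in l, ρ i * ∫ z, |S z| ∂P < ε / 2 := by
    have : Tendsto (fun i => ρ i * ∫ z, |S z| ∂P) l (𝓝 0) := by
      simpa using hρ.mul_const (∫ z, |S z| ∂P)
    exact this.eventually_lt_const (by positivity)
  have h2 : ∀ᶠ i in l, |(∫ z, tiltValue φ ((ρ i / η i) • fderiv ℝ f z) ∂P) / (ρ i / η i) - R i|
      < ε / 2 := by
    have := (continuous_abs.tendsto _).comp hR
    rw [abs_zero] at this
    exact this.eventually_lt_const (by positivity)
  filter_upwards [hρ_pos, hη_pos, hB, h1, h2] with i hρi hηi hBi h1i h2i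
  obtain ⟨r, hr, hrle⟩ := exists_gap_eq hφ hf hS hf_int hgrad_int hS_int hρi hηi
  set T := ∫ z, tiltValue φ ((ρ i / η i) • fderiv ℝ f z) ∂P
  rw [hr, hBi, ← EReal.coe_sub, EReal.abs_def]
  refine ENNReal.ofReal_le_ofReal ?_
  have hsplit : r - ρ i * R i = (r - η i * T) + ρ i * (T / (ρ i / η i) - R i) := by
    field_simp
    ring
  rw [hsplit]
  refine (abs_add_le _ _).trans ?_
  rw [abs_mul, abs_of_pos hρi]
  nlinarith

end Value

end RobustReg

open RobustReg

theorem mainTheorem2 {E : Type*} [NormedAddCommGroup E] [NormedSpace ℝ E]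
    [FiniteDimensional ℝ E] [MeasurableSpace E] [BorelSpace E]
    (φ : ℝ → ℝ≥0∞) (hφ : RobustReg.IsDivergenceFunction φ)
    (P : Measure E) [IsProbabilityMeasure P]
    (f : E → ℝ) (hf : Differentiable ℝ f)
    (S : E → ℝ) (hS : ∀ x x' : E, ‖fderiv ℝ f x - fderiv ℝ f x'‖ ≤ S x * ‖x - x'‖)
    (hf_int : Integrable f P) (hgrad_int : Integrable (fun z => ‖fderiv ℝ f z‖) P)
    (hS_int : Integrable S P)
    {ι : Type*} (l : Filter ι) (ρ η : ι → ℝ)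
    (hρ_pos : ∀ᶠ i in l, 0 < ρ i) (hη_pos : ∀ᶠ i in l, 0 < η i)
    (hρ : Tendsto ρ l (𝓝 0)) (hη : Tendsto η l (𝓝 0)) :
    (∀ C : ℝ, 0 < C → Tendsto (fun i => ρ i / η i) l (𝓝 C) →
      RobustReg.GapIsLittleO l (fun i => RobustReg.gap φ P f (ρ i) (η i))
        (fun i => RobustReg.regOCE φ P f C (ρ i)) ρ) ∧
    ((RobustReg.Popping φ ∨ RobustReg.NonPopping φ) →
      Tendsto (fun i => ρ i / η i) l atTop →
      RobustReg.GapIsLittleO l (fun i => RobustReg.gap φ P f (ρ i) (η i))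
        (fun i => (RobustReg.regNorm P f (ρ i) : EReal)) ρ) ∧
    ((∀ᶠ t in 𝓝 (1 : ℝ), φ t < ⊤) → ContDiffAt ℝ 2 (fun t => (φ t).toReal) 1 →
      0 < iteratedDeriv 2 (fun t => (φ t).toReal) 1 →
      Integrable (fun z => variance (fun b => fderiv ℝ f z b)
        (RobustReg.unifBall 1 (0 : E))) P →
      Tendsto (fun i => ρ i / η i) l (𝓝 0) →
      RobustReg.GapIsLittleO l (fun i => RobustReg.gap φ P f (ρ i) (η i))
        (fun i => (RobustReg.regVar φ P f (ρ i) (η i) : EReal)) ρ) := by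
  have hG := continuous_fderiv_of_norm_sub_le hS
  have hmeas : ∀ c : ℝ, AEStronglyMeasurable (fun z => tiltValue φ (c • fderiv ℝ f z) / c) P :=
    fun c => ((integrable_tiltValue hφ hG hgrad_int c).div_const c).aestronglyMeasurable
  have hbound : ∀ c : ℝ, 0 < c → ∀ z, ‖tiltValue φ (c • fderiv ℝ f z) / c‖ ≤ ‖fderiv ℝ f z‖ := by
    intro c hc z
    rw [Real.norm_of_nonneg (div_nonneg (tiltValue_nonneg hφ _) hc.le), div_le_iff₀ hc, mul_comm,
      ← Real.norm_of_nonneg hc.le, ← norm_smul, Real.norm_of_nonneg hc.le]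
    exact tiltValue_le_norm hφ _
  -- Along any filter on the slope, convergence for each gradient passes to the mean.
  have hdct : ∀ {L : Filter ℝ} [L.IsCountablyGenerated] {F : E → ℝ}, (∀ᶠ c in L, (0 : ℝ) < c) →
      (∀ z, Tendsto (fun c => tiltValue φ (c • fderiv ℝ f z) / c) L (𝓝 (F z))) →
      Tendsto (fun c => (∫ z, tiltValue φ (c • fderiv ℝ f z) ∂P) / c) L (𝓝 (∫ z, F z ∂P)) := by
    intro L _ F hL hF
    simp only [← integral_div]
    refine tendsto_integral_filter_of_dominated_convergence _ (Eventually.of_forall hmeas) ?_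
      hgrad_int (Eventually.of_forall hF)
    filter_upwards [hL] with c hc
    exact Eventually.of_forall (hbound c hc)
  refine ⟨fun C hC hlim => ?_, fun hpop hlim => ?_, fun _ hC2 h2 _ hlim => ?_⟩
  · refine gapIsLittleO_of_tendsto hφ hf hS hf_int hgrad_int hS_int hρ_pos hη_pos hρ
      (R := fun _ => (∫ z, tiltValue φ (C • fderiv ℝ f z) ∂P) / C)
      (Eventually.of_forall fun i => ?_) ?_
    · simp only [regOCE, oce_eq_tiltValue hφ _ hC]
      rw [eexp_coe ((integrable_tiltValue hφ hG hgrad_int C).div_const C), integral_div,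
        EReal.coe_mul]
    · have := hdct (L := 𝓝 C) (F := fun z => tiltValue φ (C • fderiv ℝ f z) / C)
        (eventually_gt_nhds hC) fun z => ?_
      · rw [integral_div] at this
        simpa using (this.comp hlim).sub_const ((∫ z, tiltValue φ (C • fderiv ℝ f z) ∂P) / C)
      · have hc : Continuous fun c : ℝ => tiltValue φ (c • fderiv ℝ f z) :=
          (continuous_tiltValue hφ).comp (by fun_prop)
        exact (hc.tendsto C).div tendsto_id hC.ne'
  · have hfin : ∀ t > 0, φ t < ⊤ := by
      rcases hpop with h | h
      · exact h.2
      · intro t ht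
        have : t ∈ {t | φ t < ⊤} := h.2 ▸ ht.le
        exact this
    refine gapIsLittleO_of_tendsto hφ hf hS hf_int hgrad_int hS_int hρ_pos hη_pos hρ
      (R := fun _ => ∫ z, ‖fderiv ℝ f z‖ ∂P) (Eventually.of_forall fun i => rfl) ?_
    simpa using ((hdct (eventually_gt_atTop 0) fun z =>
      tendsto_tiltValue_atTop hφ hfin (fderiv ℝ f z)).comp hlim).sub_const
        (∫ z, ‖fderiv ℝ f z‖ ∂P)
  · -- Both the gap and the regularizer are `o(ρ)`.
    set V := ∫ z, variance (fun b => fderiv ℝ f z b) (unifBall 1 (0 : E)) ∂P with hV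
    set s := iteratedDeriv 2 (fun t => (φ t).toReal) 1 with hs
    refine gapIsLittleO_of_tendsto hφ hf hS hf_int hgrad_int hS_int hρ_pos hη_pos hρ
      (R := fun i => ρ i / η i * (V / (2 * s))) ?_ ?_
    · filter_upwards [hη_pos] with i hi
      rw [regVar, ← hV, ← hs]
      congr 1
      field_simp
    · have hpos : ∀ t ≠ 1, φ t ≠ 0 := fun t ht => ne_zero_of_iteratedDeriv_pos hφ hC2 h2 ht
      have hlim' : Tendsto (fun i => ρ i / η i) l (𝓝[>] 0) := by
        refine tendsto_nhdsWithin_iff.2 ⟨hlim, ?_⟩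
        filter_upwards [hρ_pos, hη_pos] with i h1 h2
        exact div_pos h1 h2
      have h1 := (hdct self_mem_nhdsWithin fun z =>
        tendsto_tiltValue_zero hφ hpos (fderiv ℝ f z)).comp hlim'
      have h3 := h1.sub (hlim.mul_const (V / (2 * s)))
      simpa using h3
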